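/- Let $\mathcal N$ be a quantum channel (completely positive trace-preserving map) on two qubits that is invariant under swapping the two qubits and is not a unitary channel, i.e. not of the form $X\mapsto VXV^\dagger$ with $V$ unitary. Then there is a constant $\Gamma'>0$, depending only on $\mathcal N$, such that the following holds for all $n$ and all $D\ge 0$. Consider an $n$-qubit circuit of $D$ parallel layers, where in each layer the $n$ qubits are partitioned in an arbitrary way into pairs (the partition may differ from layer to layer), and on each pair a two-qubit unitary gate acts, followed by the channel $\mathcal N$ on the same two qubits. Let the gates be independent and distributed according to the Haar probability measure on $U(4)$, and let $\mathcal C$ be the resulting random $n$-qubit channel. Then for any two density matrices $\rho,\sigma$ on $(\mathbb C^2)^{\otimes n}$, $$\frac12\,\mathbb E\,\|\mathcal C(\rho-\sigma)\|_1\le 2^{n/2}e^{-\Gamma' D},$$ where $\|M\|_1=\operatorname{Tr}\sqrt{M^\dagger M}$ and $\mathbb E$ is the expectation over the random gates. -/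

import Mathlib

open MeasureTheory
open scoped ComplexOrder

namespace NoisyCircuit

noncomputable section

/-- The label set of the computational basis of two qubits. -/
abbrev Pair : Type := Fin 2 × Fin 2

/-- Operators on two qubits. -/
abbrev PairOp : Type := Matrix Pair Pair ℂ

/-- Operators on `n` qubits, in the computational basis of bit strings. -/
abbrev QubitOp (n : ℕ) : Type := Matrix (Fin n → Fin 2) (Fin n → Fin 2) ℂ

/-- Two-qubit gates: the unitary group `U(4)`. -/
abbrev Gate : Type := Matrix.unitaryGroup Pair ℂ

/-! ### The Haar distribution of two-qubit gates -/

instance : CompactSpace Gate := by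
  refine isCompact_iff_compactSpace.mp (?_ : IsCompact ((Matrix.unitaryGroup Pair ℂ : Submonoid PairOp) : Set PairOp))
  have hK : IsCompact (Set.univ.pi fun _ : Pair => Set.univ.pi fun _ : Pair =>
      Metric.closedBall (0 : ℂ) 1) :=
    isCompact_univ_pi fun _ => isCompact_univ_pi fun _ => isCompact_closedBall _ _
  have hc : IsClosed ((Matrix.unitaryGroup Pair ℂ : Submonoid PairOp) : Set PairOp) := by
    have h : ((Matrix.unitaryGroup Pair ℂ : Submonoid PairOp) : Set PairOp)
        = {A : PairOp | A * star A = 1} := by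
      ext A
      exact Matrix.mem_unitaryGroup_iff
    rw [h]
    exact isClosed_eq (continuous_id.mul continuous_star) continuous_const
  refine IsCompact.of_isClosed_subset hK hc ?_
  intro A hA i _ j _
  rw [mem_closedBall_zero_iff]
  exact entry_norm_bound_of_unitary hA i j

instance : MeasurableSpace Gate := borel Gate

instance : BorelSpace Gate := ⟨rfl⟩

/-- The Haar probability measure on `U(4)`. -/
def haarGate : Measure Gate := Measure.haarMeasure ⊤

/-- `∏_{D × m} U(4)` with independent Haar distributed entries: the gates of a circuit with `D`
layers of `m` gates each. -/
def haarCircuit (D m : ℕ) : Measure (Fin D → Fin m → Gate) :=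
  Measure.pi fun _ => Measure.pi fun _ => haarGate

/-! ### Channels -/

/-- The unitary channel `X ↦ U X U†` on two qubits. -/
def conjBy (U : PairOp) : Module.End ℂ PairOp where
  toFun X := U * X * U.conjTranspose
  map_add' X Y := by rw [mul_add, add_mul]
  map_smul' c X := by simp

/-- A two-qubit quantum channel (CPTP map), in Kraus form. -/
def IsChannel (N : Module.End ℂ PairOp) : Prop :=
  ∃ (r : ℕ) (K : Fin r → PairOp),
    ∑ k, (K k).conjTranspose * K k = 1 ∧
    ∀ X : PairOp, N X = ∑ k, K k * X * (K k).conjTranspose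

/-- `N` commutes with swapping the two qubits. -/
def IsSwapSymmetric (N : Module.End ℂ PairOp) : Prop :=
  ∀ X : PairOp, N (X.submatrix Prod.swap Prod.swap) = (N X).submatrix Prod.swap Prod.swap

/-- `N` is the conjugation by a fixed unitary. -/
def IsUnitaryChannel (N : Module.End ℂ PairOp) : Prop :=
  ∃ V : Gate, N = conjBy (V : PairOp)

/-- The bit string `x` with the bits at `i` and `j` replaced by `a.1` and `a.2`. -/
def setPair {n : ℕ} (i j : Fin n) (x : Fin n → Fin 2) (a : Pair) : Fin n → Fin 2 :=
  Function.update (Function.update x i a.1) j a.2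

/-- `Φ ⊗ id`: the two-qubit map `Φ` acting on the qubits `i ≠ j` (in this order) of `n` qubits. -/
def onPair {n : ℕ} (Φ : Module.End ℂ PairOp) (i j : Fin n) : Module.End ℂ (QubitOp n) where
  toFun X := Matrix.of fun x y =>
    Φ (X.submatrix (setPair i j x) (setPair i j y)) (x i, x j) (y i, y j)
  map_add' X Y := by
    ext x y
    simp only [Matrix.of_apply, Matrix.add_apply]
    rw [← Matrix.add_apply, ← map_add]
    rfl
  map_smul' c X := by
    ext x y
    simp only [Matrix.of_apply, Matrix.smul_apply, RingHom.id_apply]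
    rw [← Matrix.smul_apply, ← map_smul]
    rfl

/-! ### Noisy parallel circuits -/

/-- A parallel layer on `n` qubits: a partition of the qubits into `m` pairs; the `g`-th gate acts
on the qubits `L (g, 0)` and `L (g, 1)`, so that each qubit is in exactly one gate. -/
abbrev Layer (n m : ℕ) : Type := Fin m × Fin 2 ≃ Fin n

/-- The gate `U`, followed by the noise channel `N`, on the `g`-th pair of the layer. -/
def noisyGate {n m : ℕ} (N : Module.End ℂ PairOp) (L : Layer n m) (g : Fin m) (U : Gate) :
    Module.End ℂ (QubitOp n) :=
  onPair (N ∘ₗ conjBy (U : PairOp)) (L (g, 0)) (L (g, 1))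

/-- A noisy layer: the composition of its noisy gates (which act on disjoint pairs). -/
def noisyLayer {n m : ℕ} (N : Module.End ℂ PairOp) (L : Layer n m) (U : Fin m → Gate) :
    Module.End ℂ (QubitOp n) :=
  (List.ofFn fun g => noisyGate N L g (U g)).reverse.prod

/-- The channel of a noisy circuit: layer `0` acts first, layer `D - 1` last. -/
def noisyCircuit {n m D : ℕ} (N : Module.End ℂ PairOp) (A : Fin D → Layer n m)
    (U : Fin D → Fin m → Gate) : Module.End ℂ (QubitOp n) :=
  (List.ofFn fun l => noisyLayer N (A l) (U l)).reverse.prod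

/-! ### States and the trace norm -/

/-- Density matrices. -/
def IsState {n : ℕ} (ρ : QubitOp n) : Prop :=
  ρ.PosSemidef ∧ ρ.trace = 1

/-- The trace norm `Tr √(M† M)`, the sum of the singular values of `M`. -/
def traceNorm {n : ℕ} (M : QubitOp n) : ℝ :=
  ∑ x, Real.sqrt ((Matrix.isHermitian_conjTranspose_mul_self M).eigenvalues x)

end

end NoisyCircuit

open NoisyCircuit

/-! The argument is a second moment bound. For a set `S` of qubits let `subForm S X` be the trace of
`X ⊗ X` against the swaps of the two copies of the qubits in `S`; for Hermitian `X` and full `S` it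
is the squared Hilbert–Schmidt norm. Cauchy–Schwarz gives `‖X‖₁² ≤ 2^n Tr X²`, so it suffices that
the mean of `Tr X²` for the output `X` on the input `ρ - σ` is at most `4 q^D` with some `q < 1`
depending only on `N`.

Averaging over one noisy Haar gate on the pair `i, j` gives a symmetric bilinear form in the input
blocks that is invariant under conjugation, hence a combination of `tr Y * tr Z` and `tr (Y * Z)`
(`ConjInvariant.apply_eq`). In terms of `S`, the mean is `a * subForm (S \ {i, j}) + b * subForm (S
∪ {i, j})` with weights `a, b ≥ 0` (`integral_subForm_gate`). If `S` misses the pair, then `a = 1`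
and `b = 0`. Otherwise `a + b` is the mean purity of the marked output qubits for a pure input.

`exists_gate_weights` separates two cases. If the mean two-qubit output purity `p` is below one,
then subadditivity of the linear entropy, with equal one-qubit purities by swap symmetry, bounds all
these purities by `q = (1 + p) / 2 < 1`. If `p = 1`, every pure input has a pure output, so the
Kraus operators are either multiples of one matrix, making `N` unitary, or of rank one with common
range, making `N` a replacement channel (`isUnitaryChannel_or_constant`). For a replacement channel
`b = 0`.

The term of `S = ∅` is the squared trace, which stays zero. Any other `S` meets a gate of every
layer, so in the first case each layer multiplies the bound over all `S` by `q`; in the second a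
single layer reduces every `S` to `∅`. -/

namespace NoisyCircuit

/-! ### Invariance of the Haar measure on gates and circuits -/

section Haar

instance : SecondCountableTopology Gate := by
  have : SecondCountableTopology PairOp :=
    inferInstanceAs (SecondCountableTopology (Pair → Pair → ℂ))
  exact TopologicalSpace.Subtype.secondCountableTopology _

instance : Measure.IsHaarMeasure haarGate :=
  inferInstanceAs (Measure.IsHaarMeasure (Measure.haarMeasure ⊤))

instance : IsProbabilityMeasure haarGate := ⟨by
  have := Measure.haarMeasure_self (G := Gate) (K₀ := ⊤)
  simpa [haarGate] using this⟩

/-- Unimodularity of a compact group: a right translate of Haar measure is again a Haar probability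
measure, and that measure is unique. -/
instance : haarGate.IsMulRightInvariant := ⟨fun g => by
  have : IsProbabilityMeasure (Measure.map (· * g) haarGate) :=
    Measure.isProbabilityMeasure_map (measurable_mul_const g).aemeasurable
  exact Measure.isHaarMeasure_eq_of_isProbabilityMeasure _ _⟩

instance (D m : ℕ) : IsProbabilityMeasure (haarCircuit D m) :=
  inferInstanceAs (IsProbabilityMeasure (Measure.pi fun _ => Measure.pi fun _ => haarGate))

instance (m : ℕ) : (Measure.pi fun _ : Fin m => haarGate).IsMulLeftInvariant :=
  Measure.pi.isMulLeftInvariant _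

instance (D m : ℕ) : (haarCircuit D m).IsMulLeftInvariant :=
  Measure.pi.isMulLeftInvariant fun _ : Fin D => Measure.pi fun _ : Fin m => haarGate

end Haar

theorem exists_perm_apply_eq {ι : Type*} [DecidableEq ι] {i₀ j₀ i j : ι} (h₀ : i₀ ≠ j₀) (h : i ≠ j) :
    ∃ σ : Equiv.Perm ι, σ i₀ = i ∧ σ j₀ = j := by
  refine ⟨Equiv.swap (Equiv.swap i₀ i j₀) j * Equiv.swap i₀ i, ?_, ?_⟩
  · have h1 : i ≠ Equiv.swap i₀ i j₀ := by
      intro h2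
      refine h₀ ((Equiv.swap i₀ i).injective ?_)
      rwa [Equiv.swap_apply_left]
    simp [Equiv.swap_apply_of_ne_of_ne h1 h]
  · simp

/-! ### Conjugation-invariant bilinear forms on matrices -/

section Twirl

open Matrix

variable {ι : Type*} [Fintype ι] [DecidableEq ι]

/-- The unitary matrix of a permutation of the basis. -/
noncomputable def permUnitary (σ : Equiv.Perm ι) : Matrix.unitaryGroup ι ℂ :=
  ⟨(1 : Matrix ι ι ℂ).submatrix σ id, by
    rw [Matrix.mem_unitaryGroup_iff, star_eq_conjTranspose, conjTranspose_submatrix,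
      conjTranspose_one]
    exact (submatrix_mul_equiv (1 : Matrix ι ι ℂ) 1 σ (Equiv.refl ι) σ).trans (by simp)⟩

theorem permUnitary_conj (σ : Equiv.Perm ι) (X : Matrix ι ι ℂ) :
    (permUnitary σ : Matrix ι ι ℂ) * X * (permUnitary σ : Matrix ι ι ℂ)ᴴ =
      X.submatrix σ σ := by
  ext x y
  simp [permUnitary, Matrix.mul_apply, Matrix.one_apply]

/-- The bilinear form `B` is invariant under simultaneous conjugation by unitaries. -/
def ConjInvariant (B : Matrix ι ι ℂ →ₗ[ℂ] Matrix ι ι ℂ →ₗ[ℂ] ℂ) : Prop :=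
  ∀ (V : Matrix.unitaryGroup ι ℂ) (Y Z : Matrix ι ι ℂ),
    B ((V : Matrix ι ι ℂ) * Y * (V : Matrix ι ι ℂ)ᴴ) ((V : Matrix ι ι ℂ) * Z * (V : Matrix ι ι ℂ)ᴴ)
      = B Y Z

variable {B : Matrix ι ι ℂ →ₗ[ℂ] Matrix ι ι ℂ →ₗ[ℂ] ℂ}

theorem ConjInvariant.single_perm (hB : ConjInvariant B) (σ : Equiv.Perm ι) (i j : ι) :
    B (single (σ i) (σ i) 1) (single (σ j) (σ j) 1) = B (single i i 1) (single j j 1) := by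
  have key : ∀ k, (single (σ k) (σ k) (1 : ℂ)).submatrix σ σ = single k k 1 := by
    intro k
    ext x y
    simp [Matrix.single_apply]
  rw [← hB (permUnitary σ), permUnitary_conj, permUnitary_conj, key, key]

/-- Basis permutations are unitary and two-transitive, so the value of `B` on two diagonal matrix
units depends only on whether their indices agree. -/
theorem ConjInvariant.apply_diagonal (hB : ConjInvariant B) {i₀ j₀ : ι} (h₀ : i₀ ≠ j₀) (d : ι → ℂ) :
    B (diagonal d) (diagonal d) =
      B (single i₀ i₀ 1) (single j₀ j₀ 1) * (∑ i, d i) ^ 2 +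
      (B (single i₀ i₀ 1) (single i₀ i₀ 1) - B (single i₀ i₀ 1) (single j₀ j₀ 1)) *
        ∑ i, d i ^ 2 := by
  have hd : diagonal d = ∑ i, d i • single i i (1 : ℂ) := by
    ext x y
    simp [Matrix.sum_apply, Matrix.single_apply, Matrix.diagonal_apply, ite_and]
  have hterm : ∀ i j, B (single i i 1) (single j j 1) =
      B (single i₀ i₀ 1) (single j₀ j₀ 1) + if i = j then
        B (single i₀ i₀ 1) (single i₀ i₀ 1) - B (single i₀ i₀ 1) (single j₀ j₀ 1) else 0 := by
    intro i j
    split_ifs with h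
    · subst h
      have := hB.single_perm (Equiv.swap i₀ i) i₀ i₀
      rw [Equiv.swap_apply_left] at this
      rw [this]; ring
    · obtain ⟨σ, rfl, rfl⟩ := exists_perm_apply_eq h₀ h
      rw [hB.single_perm]; ring
  generalize B (single i₀ i₀ 1) (single j₀ j₀ 1) = a at hterm ⊢
  generalize B (single i₀ i₀ 1) (single i₀ i₀ 1) - a = e at hterm ⊢
  rw [hd]
  simp only [map_sum, map_smul, LinearMap.sum_apply, LinearMap.smul_apply, smul_eq_mul, hterm,
    mul_add, Finset.sum_add_distrib, mul_ite, mul_zero, Finset.sum_ite_eq',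
    Finset.mem_univ, if_true]
  congr 1
  · rw [pow_two, Finset.sum_mul_sum, Finset.mul_sum]
    refine Finset.sum_congr rfl fun i _ => ?_
    rw [Finset.mul_sum, Finset.mul_sum]
    exact Finset.sum_congr rfl fun j _ => by ring
  · rw [Finset.mul_sum]
    exact Finset.sum_congr rfl fun j _ => by ring

theorem ConjInvariant.apply_self_of_isHermitian (hB : ConjInvariant B) {i₀ j₀ : ι} (h₀ : i₀ ≠ j₀)
    {H : Matrix ι ι ℂ} (hH : H.IsHermitian) :
    B H H =
      B (single i₀ i₀ 1) (single j₀ j₀ 1) * (H.trace * H.trace) +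
      (B (single i₀ i₀ 1) (single i₀ i₀ 1) - B (single i₀ i₀ 1) (single j₀ j₀ 1)) *
        (H * H).trace := by
  obtain ⟨V, d, rfl⟩ : ∃ (V : Matrix.unitaryGroup ι ℂ) (d : ι → ℂ),
      H = (V : Matrix ι ι ℂ) * diagonal d * (V : Matrix ι ι ℂ)ᴴ :=
    ⟨hH.eigenvectorUnitary, RCLike.ofReal ∘ hH.eigenvalues, hH.spectral_theorem⟩
  have hV : (V : Matrix ι ι ℂ)ᴴ * (V : Matrix ι ι ℂ) = 1 := Unitary.coe_star_mul_self V
  have h1 : ((V : Matrix ι ι ℂ) * diagonal d * (V : Matrix ι ι ℂ)ᴴ).trace = ∑ i, d i := by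
    rw [Matrix.trace_mul_comm, ← mul_assoc, hV, one_mul, Matrix.trace_diagonal]
  have h2 : (((V : Matrix ι ι ℂ) * diagonal d * (V : Matrix ι ι ℂ)ᴴ) *
      ((V : Matrix ι ι ℂ) * diagonal d * (V : Matrix ι ι ℂ)ᴴ)).trace = ∑ i, d i ^ 2 := by
    rw [show ((V : Matrix ι ι ℂ) * diagonal d * (V : Matrix ι ι ℂ)ᴴ) *
      ((V : Matrix ι ι ℂ) * diagonal d * (V : Matrix ι ι ℂ)ᴴ) =
      (V : Matrix ι ι ℂ) * (diagonal d * ((V : Matrix ι ι ℂ)ᴴ * (V : Matrix ι ι ℂ)) * diagonal d) *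
        (V : Matrix ι ι ℂ)ᴴ by noncomm_ring, hV, Matrix.trace_mul_comm, ← mul_assoc, hV, one_mul,
      mul_one, diagonal_mul_diagonal, Matrix.trace_diagonal]
    exact Finset.sum_congr rfl fun i _ => (pow_two _).symm
  rw [hB, hB.apply_diagonal h₀, h1, h2, pow_two]

/-- A symmetric bilinear form on matrices that is invariant under conjugation by unitaries is a
combination of `tr Y * tr Z` and `tr (Y * Z)`. -/
theorem ConjInvariant.apply_eq (hB : ConjInvariant B) (hs : ∀ Y Z, B Y Z = B Z Y)
    {i₀ j₀ : ι} (h₀ : i₀ ≠ j₀) (Y Z : Matrix ι ι ℂ) :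
    B Y Z =
      B (single i₀ i₀ 1) (single j₀ j₀ 1) * (Y.trace * Z.trace) +
      (B (single i₀ i₀ 1) (single i₀ i₀ 1) - B (single i₀ i₀ 1) (single j₀ j₀ 1)) *
        (Y * Z).trace := by
  have herm : ∀ H K : selfAdjoint (Matrix ι ι ℂ), B (H : Matrix ι ι ℂ) (K : Matrix ι ι ℂ) =
      B (single i₀ i₀ 1) (single j₀ j₀ 1) *
        ((H : Matrix ι ι ℂ).trace * (K : Matrix ι ι ℂ).trace) +
      (B (single i₀ i₀ 1) (single i₀ i₀ 1) - B (single i₀ i₀ 1) (single j₀ j₀ 1)) *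
        ((H : Matrix ι ι ℂ) * (K : Matrix ι ι ℂ)).trace := by
    intro H K
    have h1 := hB.apply_self_of_isHermitian h₀ (H := H) H.2
    have h2 := hB.apply_self_of_isHermitian h₀ (H := K) K.2
    have h3 := hB.apply_self_of_isHermitian h₀ (H := (H + K : selfAdjoint (Matrix ι ι ℂ))) (H + K).2
    simp only [AddSubgroup.coe_add, map_add, LinearMap.add_apply, trace_add, mul_add,
      add_mul] at h3
    rw [hs K H, Matrix.trace_mul_comm (K : Matrix ι ι ℂ) (H : Matrix ι ι ℂ), h1, h2] at h3
    linear_combination h3 / 2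
  -- Polarization has settled Hermitian pairs; complex bilinearity extends the formula through real
  -- and imaginary parts.
  rw [← realPart_add_I_smul_imaginaryPart Y, ← realPart_add_I_smul_imaginaryPart Z]
  simp only [map_add, LinearMap.add_apply, map_smul, LinearMap.smul_apply, trace_add, trace_smul,
    mul_add, add_mul, herm, smul_eq_mul, Matrix.smul_mul, Matrix.mul_smul]
  ring

end Twirl

/-! ### Families of matrices with pairwise parallel images -/

section Classification

open Matrix

variable {ι κ : Type*}

/-- The vanishing of all `2 × 2` minors of the pair of vectors `u`, `w`. -/
def Parallel (u w : ι → ℂ) : Prop := ∀ x y, u x * w y = u y * w x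

theorem Parallel.eq_smul {u w : ι → ℂ} (h : Parallel u w) {x₀ : ι} (hx : u x₀ ≠ 0) :
    w = (w x₀ / u x₀) • u := by
  ext y
  have := h x₀ y
  simp only [Pi.smul_apply, smul_eq_mul]
  field_simp
  linear_combination this

theorem exists_ne_zero_of_not_parallel {u w : ι → ℂ} (h : ¬ Parallel u w) : ∃ x, u x ≠ 0 := by
  by_contra! h0
  exact h fun x y => by simp [h0]

variable [Fintype ι]

/-- Polarization of the condition that `K ψ` and `L ψ` are parallel for all `ψ`. -/
theorem parallel_polarize {K L : Matrix ι ι ℂ}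
    (h : ∀ ψ, Parallel (K *ᵥ ψ) (L *ᵥ ψ)) (a c : ι → ℂ) (x y : ι) :
    (K *ᵥ a) x * (L *ᵥ c) y - (K *ᵥ a) y * (L *ᵥ c) x +
      ((K *ᵥ c) x * (L *ᵥ a) y - (K *ᵥ c) y * (L *ᵥ a) x) = 0 := by
  have h1 := h (a + c) x y
  simp only [mulVec_add, Pi.add_apply] at h1
  linear_combination h1 - h a x y - h c x y

/-- On `a` and `b` the matrix `L` is a scalar times `K`, and polarization makes the two scalars
equal to one `t`. For any `c`, polarizing against `a` and `b` makes `L c - t K c` parallel to both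
`K a` and `K b`, which are independent, so it vanishes. -/
theorem exists_eq_smul_of_parallel {K L : Matrix ι ι ℂ} [DecidableEq ι]
    (h : ∀ ψ, Parallel (K *ᵥ ψ) (L *ᵥ ψ)) {a b : ι → ℂ}
    (hab : ¬ Parallel (K *ᵥ a) (K *ᵥ b)) : ∃ t : ℂ, L = t • K := by
  obtain ⟨xa, ha⟩ := exists_ne_zero_of_not_parallel hab
  have hba : ¬ Parallel (K *ᵥ b) (K *ᵥ a) := fun h' => hab fun x y => by
    linear_combination -h' x y
  obtain ⟨xb, hb⟩ := exists_ne_zero_of_not_parallel hba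
  obtain ⟨ta, hta⟩ : ∃ t : ℂ, L *ᵥ a = t • K *ᵥ a := ⟨_, (h a).eq_smul ha⟩
  obtain ⟨tb, htb⟩ : ∃ t : ℂ, L *ᵥ b = t • K *ᵥ b := ⟨_, (h b).eq_smul hb⟩
  have hp := parallel_polarize h
  have htab : ta = tb := by
    by_contra hne
    refine hab fun x y => ?_
    have h1 := hp a b x y
    rw [hta, htb] at h1
    simp only [Pi.smul_apply, smul_eq_mul] at h1
    have h2 : (tb - ta) * ((K *ᵥ a) x * (K *ᵥ b) y - (K *ᵥ a) y * (K *ᵥ b) x) = 0 := by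
      linear_combination h1
    rcases mul_eq_zero.mp h2 with h3 | h3
    · exact absurd (sub_eq_zero.mp h3).symm hne
    · exact sub_eq_zero.mp h3
  subst htab
  have hc : ∀ c, L *ᵥ c = ta • K *ᵥ c := by
    intro c
    have pa : Parallel (K *ᵥ a) (L *ᵥ c - ta • K *ᵥ c) := fun x y => by
      have h1 := hp a c x y
      rw [hta] at h1
      simp only [Pi.smul_apply, Pi.sub_apply, smul_eq_mul] at h1 ⊢
      linear_combination h1
    have pb : Parallel (K *ᵥ b) (L *ᵥ c - ta • K *ᵥ c) := fun x y => by
      have h1 := hp b c x y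
      rw [htb] at h1
      simp only [Pi.smul_apply, Pi.sub_apply, smul_eq_mul] at h1 ⊢
      linear_combination h1
    obtain ⟨s, hs⟩ : ∃ s : ℂ, L *ᵥ c - ta • K *ᵥ c = s • K *ᵥ a := ⟨_, pa.eq_smul ha⟩
    have hs0 : s = 0 := by
      by_contra hne
      refine hba fun x y => ?_
      have h1 := pb x y
      rw [hs] at h1
      simp only [Pi.smul_apply, smul_eq_mul] at h1
      exact mul_left_cancel₀ hne (by linear_combination h1)
    rw [hs0, zero_smul] at hs
    exact sub_eq_zero.mp hs
  refine ⟨ta, ?_⟩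
  ext x y
  have := congrFun (hc (Pi.single y 1)) x
  simpa using this

/-- Matrices that send every vector to pairwise parallel vectors are multiples of one matrix, or
have rank at most one with a common range. -/
theorem parallel_family {K : κ → Matrix ι ι ℂ} [DecidableEq ι]
    (h : ∀ k l ψ, Parallel (K k *ᵥ ψ) (K l *ᵥ ψ)) :
    (∃ (K₀ : Matrix ι ι ℂ) (c : κ → ℂ), ∀ k, K k = c k • K₀) ∨
      ∃ (v : ι → ℂ) (w : κ → ι → ℂ), ∀ k, K k = vecMulVec v (w k) := by
  -- If some `K k` has rank at least two, all the others are multiples of it. Otherwise all ranks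
  -- are at most one, and polarization puts every range on the line of a nonzero `K k *ᵥ a`.
  by_cases h1 : ∃ k a b, ¬ Parallel (K k *ᵥ a) (K k *ᵥ b)
  · obtain ⟨k, a, b, hab⟩ := h1
    choose c hc using fun l => exists_eq_smul_of_parallel (h k l) hab
    exact Or.inl ⟨K k, c, hc⟩
  push Not at h1
  right
  by_cases h2 : ∃ k a x, (K k *ᵥ a) x ≠ 0
  · obtain ⟨k, a, x₀, hx⟩ := h2
    refine ⟨K k *ᵥ a, fun l y => K l x₀ y / (K k *ᵥ a) x₀, fun l => ?_⟩
    have hpar : ∀ c, Parallel (K k *ᵥ a) (K l *ᵥ c) := by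
      intro c x y
      have h3 := parallel_polarize (h k l) a c x y
      rw [(h1 k a c).eq_smul hx] at h3
      simp only [Pi.smul_apply, smul_eq_mul] at h3
      have h4 := h k l a x y
      linear_combination h3 - ((K k *ᵥ c) x₀ / (K k *ᵥ a) x₀) * h4
    ext x y
    have := congrFun ((hpar (Pi.single y 1)).eq_smul hx) x
    simp only [mulVec_single_one, Pi.smul_apply, smul_eq_mul, Matrix.col_apply] at this
    rw [this, vecMulVec_apply]
    ring
  · push Not at h2
    refine ⟨0, fun _ => 0, fun k => ?_⟩
    ext x y
    have := h2 k (Pi.single y 1) x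
    simpa [vecMulVec_apply] using this

/-- Equality case of Cauchy–Schwarz: by Lagrange's identity the Gram determinant is half the sum of
the squared moduli of the `2 × 2` minors. -/
theorem parallel_of_sum_eq_zero {u w : ι → ℂ}
    (h : (∑ a, u a * star (u a)) * (∑ b, w b * star (w b)) -
      (∑ a, star (u a) * w a) * (∑ a, u a * star (w a)) = 0) : Parallel u w := by
  have key : ∑ x, ∑ y, (u x * w y - u y * w x) * star (u x * w y - u y * w x) = 0 := by
    have e : ∀ x y, (u x * w y - u y * w x) * star (u x * w y - u y * w x) =
        (u x * star (u x)) * (w y * star (w y)) + (w x * star (w x)) * (u y * star (u y))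
        - (u x * star (w x)) * (star (u y) * w y) - (star (u x) * w x) * (u y * star (w y)) := by
      intro x y
      simp only [star_sub, star_mul']
      ring
    simp only [e, Finset.sum_sub_distrib, Finset.sum_add_distrib, ← Finset.mul_sum,
      ← Finset.sum_mul]
    linear_combination 2 * h
  have nn : ∀ z : ℂ, 0 ≤ z * star z := fun z => mul_star_self_nonneg z
  rw [Finset.sum_eq_zero_iff_of_nonneg fun x _ => Finset.sum_nonneg fun y _ => nn _] at key
  intro x y
  have h1 := key x (Finset.mem_univ _)
  rw [Finset.sum_eq_zero_iff_of_nonneg fun y _ => nn _] at h1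
  have h2 := h1 y (Finset.mem_univ _)
  rw [mul_eq_zero, star_eq_zero, or_self] at h2
  exact sub_eq_zero.mp h2

end Classification

/-! ### Unitaries with a prescribed column -/

section Column

open Matrix

/-- Turns statements about one column of every gate into statements about every unit vector. -/
theorem exists_unitary_column {ι : Type*} [Fintype ι] [DecidableEq ι] (i₀ : ι)
    (ψ : EuclideanSpace ℂ ι) (hψ : ‖ψ‖ = 1) :
    ∃ V : Matrix.unitaryGroup ι ℂ, ∀ x, (V : Matrix ι ι ℂ) x i₀ = ψ x := by
  have ho : Orthonormal ℂ (({i₀} : Set ι).domRestrict fun _ => ψ) := by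
    refine ⟨fun _ => hψ, fun i j hij => ?_⟩
    exact absurd (Subsingleton.elim i j) hij
  obtain ⟨b, hb⟩ := ho.exists_orthonormalBasis_extension_of_card_eq (by simp)
  refine ⟨⟨_, (EuclideanSpace.basisFun ι ℂ).toMatrix_orthonormalBasis_mem_unitary b⟩, fun x => ?_⟩
  simp [Module.Basis.toMatrix_apply, hb i₀ rfl]

end Column

/-! ### Swap forms on two qubits and their positivity -/

section PairForm

open Matrix

/-- The label `a` with the entries marked by `s` and `t` replaced by those of `b`. -/
def pairMix (s t : Bool) (a b : Pair) : Pair :=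
  (bif s then b.1 else a.1, bif t then b.2 else a.2)

/-- The trace of `Y ⊗ Z` against the swap operators on the qubits marked by `s` and `t`. -/
noncomputable def pairForm (s t : Bool) : PairOp →ₗ[ℂ] PairOp →ₗ[ℂ] ℂ :=
  LinearMap.mk₂ ℂ (fun Y Z => ∑ a, ∑ b, Y a (pairMix s t a b) * Z b (pairMix s t b a))
    (fun Y Y' Z => by simp only [Matrix.add_apply, add_mul, Finset.sum_add_distrib])
    (fun c Y Z => by simp only [Matrix.smul_apply, smul_mul_assoc, Finset.smul_sum])
    (fun Y Z Z' => by simp only [Matrix.add_apply, mul_add, Finset.sum_add_distrib])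
    (fun c Y Z => by simp only [Matrix.smul_apply, mul_smul_comm, Finset.smul_sum])

theorem pairForm_apply (s t : Bool) (Y Z : PairOp) :
    pairForm s t Y Z = ∑ a, ∑ b, Y a (pairMix s t a b) * Z b (pairMix s t b a) := rfl

theorem pairForm_comm (s t : Bool) (Y Z : PairOp) : pairForm s t Y Z = pairForm s t Z Y := by
  rw [pairForm_apply, pairForm_apply, Finset.sum_comm]
  exact Finset.sum_congr rfl fun b _ => Finset.sum_congr rfl fun a _ => mul_comm _ _

theorem pairForm_false_false (Y Z : PairOp) :
    pairForm false false Y Z = Y.trace * Z.trace := by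
  simp [pairForm_apply, pairMix, Matrix.trace, Finset.sum_mul_sum]

theorem pairForm_true_true (Y Z : PairOp) : pairForm true true Y Z = (Y * Z).trace := by
  simp [pairForm_apply, pairMix, Matrix.trace, Matrix.mul_apply]

theorem pairForm_swap (s t : Bool) (Y Z : PairOp) :
    pairForm s t (Y.submatrix Prod.swap Prod.swap) (Z.submatrix Prod.swap Prod.swap) =
      pairForm t s Y Z := by
  rw [pairForm_apply, pairForm_apply]
  refine Fintype.sum_equiv (Equiv.prodComm _ _) _ _ fun a => ?_
  exact Fintype.sum_equiv (Equiv.prodComm _ _) _ _ fun b => rfl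

/-- The value is the squared Hilbert–Schmidt norm of the partial trace of `H` to the marked qubits.
-/
theorem pairForm_self_nonneg (s t : Bool) {H : PairOp} (hH : H.IsHermitian) :
    0 ≤ pairForm s t H H := by
  have nn : ∀ z : ℂ, 0 ≤ z * star z := fun z => mul_star_self_nonneg z
  have hs : ∀ a b, H b a = star (H a b) := fun a b => (hH.apply b a).symm
  cases s <;> cases t
  · rw [pairForm_false_false]
    have : star H.trace = H.trace := by rw [← Matrix.trace_conjTranspose, hH.eq]
    simpa [this] using nn H.trace
  · have : pairForm false true H H =
        ∑ β, ∑ β', (∑ α, H (α, β) (α, β')) * star (∑ α, H (α, β) (α, β')) := by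
      simp only [pairForm_apply, pairMix, star_add, ← hs, Fintype.sum_prod_type,
        Fin.sum_univ_two, cond_true, cond_false]
      ring
    rw [this]
    exact Finset.sum_nonneg fun _ _ => Finset.sum_nonneg fun _ _ => nn _
  · have : pairForm true false H H =
        ∑ β, ∑ β', (∑ α, H (β, α) (β', α)) * star (∑ α, H (β, α) (β', α)) := by
      simp only [pairForm_apply, pairMix, star_add, ← hs, Fintype.sum_prod_type,
        Fin.sum_univ_two, cond_true, cond_false]
      ring
    rw [this]
    exact Finset.sum_nonneg fun _ _ => Finset.sum_nonneg fun _ _ => nn _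
  · simp only [pairForm_apply, pairMix, cond_true]
    refine Finset.sum_nonneg fun a _ => Finset.sum_nonneg fun b _ => ?_
    rw [hs a b]
    exact nn _

/-- The rank one operator `u u†`. -/
def rankOne (u : Pair → ℂ) : PairOp := vecMulVec u (star u)

/-- The value is the overlap of two positive operators, the reductions of `u u†` and `w w†`. With
one marked qubit it is a sum of squared moduli of entries of a product of `u` and `w`, reshaped as
`2 × 2` matrices. -/
theorem pairForm_rankOne_nonneg (s t : Bool) (u w : Pair → ℂ) :
    0 ≤ pairForm s t (rankOne u) (rankOne w) := by
  have nn : ∀ z : ℂ, 0 ≤ z * star z := fun z => mul_star_self_nonneg z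
  cases s <;> cases t
  · have : pairForm false false (rankOne u) (rankOne w) =
        (∑ a, u a * star (u a)) * ∑ a, w a * star (w a) := by
      rw [pairForm_false_false]; rfl
    rw [this]
    exact mul_nonneg (Finset.sum_nonneg fun _ _ => nn _) (Finset.sum_nonneg fun _ _ => nn _)
  · have : pairForm false true (rankOne u) (rankOne w) =
        ∑ β, ∑ β', (∑ α, u (β, α) * star (w (β', α))) * star (∑ α, u (β, α) * star (w (β', α))) := by
      simp only [pairForm_apply, pairMix, rankOne, vecMulVec_apply, Pi.star_apply, star_add,
        star_mul', star_star, Fintype.sum_prod_type, Fin.sum_univ_two, cond_true, cond_false]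
      ring
    rw [this]
    exact Finset.sum_nonneg fun _ _ => Finset.sum_nonneg fun _ _ => nn _
  · have : pairForm true false (rankOne u) (rankOne w) =
        ∑ β, ∑ β', (∑ α, u (α, β) * star (w (α, β'))) * star (∑ α, u (α, β) * star (w (α, β'))) := by
      simp only [pairForm_apply, pairMix, rankOne, vecMulVec_apply, Pi.star_apply, star_add,
        star_mul', star_star, Fintype.sum_prod_type, Fin.sum_univ_two, cond_true, cond_false]
      ring
    rw [this]
    exact Finset.sum_nonneg fun _ _ => Finset.sum_nonneg fun _ _ => nn _
  · have : pairForm true true (rankOne u) (rankOne w) =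
        (∑ a, u a * star (w a)) * star (∑ a, u a * star (w a)) := by
      rw [star_sum, Finset.sum_mul_sum, pairForm_apply]
      refine Finset.sum_congr rfl fun a _ => Finset.sum_congr rfl fun b _ => ?_
      simp only [pairMix, rankOne, vecMulVec_apply, Pi.star_apply, star_mul', star_star, cond_true]
      ring
    rw [this]
    exact nn _

/-- Subadditivity of the linear entropy, for a pair of rank one operators. -/
theorem pairForm_rankOne_subadditive (u w : Pair → ℂ) :
    0 ≤ pairForm false false (rankOne u) (rankOne w) - pairForm true false (rankOne u) (rankOne w)
      - pairForm false true (rankOne u) (rankOne w)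
      + pairForm true true (rankOne u) (rankOne w) := by
  -- The combination is the expectation of `(1 - F₁)(1 - F₂)` in `u ⊗ w`, where `F₁`, `F₂` swap the
  -- copies of each qubit. On two copies of a qubit `1 - F` projects, up to a factor, onto the
  -- singlet, so only the squared modulus of one amplitude remains.
  have : pairForm false false (rankOne u) (rankOne w)
      - pairForm true false (rankOne u) (rankOne w)
      - pairForm false true (rankOne u) (rankOne w)
      + pairForm true true (rankOne u) (rankOne w) =
      (u (0, 0) * w (1, 1) - u (1, 0) * w (0, 1) - u (0, 1) * w (1, 0) + u (1, 1) * w (0, 0)) *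
      star (u (0, 0) * w (1, 1) - u (1, 0) * w (0, 1) - u (0, 1) * w (1, 0)
        + u (1, 1) * w (0, 0)) := by
    simp only [pairForm_apply, pairMix, rankOne, vecMulVec_apply, Pi.star_apply, star_sub,
      star_add, star_mul', Fintype.sum_prod_type, Fin.sum_univ_two, cond_true, cond_false]
    ring
  rw [this]
  exact mul_star_self_nonneg _

theorem pairForm_rankOne_gap (u w : Pair → ℂ) :
    pairForm false false (rankOne u) (rankOne w) - pairForm true true (rankOne u) (rankOne w) =
      (∑ a, u a * star (u a)) * (∑ b, w b * star (w b)) -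
      (∑ a, star (u a) * w a) * (∑ a, u a * star (w a)) := by
  rw [pairForm_false_false, pairForm_apply]
  congr 1
  rw [Finset.sum_mul_sum, Finset.sum_comm]
  refine Finset.sum_congr rfl fun a _ => Finset.sum_congr rfl fun b _ => ?_
  simp only [pairMix, rankOne, vecMulVec_apply, Pi.star_apply, cond_true]
  ring

theorem pairForm_rankOne_gap_nonneg (u w : Pair → ℂ) :
    0 ≤ pairForm false false (rankOne u) (rankOne w)
      - pairForm true true (rankOne u) (rankOne w) := by
  have : pairForm false false (rankOne u) (rankOne w)
      - pairForm true true (rankOne u) (rankOne w) =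
      (∑ x, ∑ y, (u x * w y - u y * w x) * star (u x * w y - u y * w x)) * 2⁻¹ := by
    have e : ∀ x y, (u x * w y - u y * w x) * star (u x * w y - u y * w x) =
        (u x * star (u x)) * (w y * star (w y)) + (w x * star (w x)) * (u y * star (u y))
        - (u x * star (w x)) * (star (u y) * w y) - (star (u x) * w x) * (u y * star (w y)) := by
      intro x y
      simp only [star_sub, star_mul']
      ring
    rw [pairForm_rankOne_gap]
    simp only [e, Finset.sum_sub_distrib, Finset.sum_add_distrib, ← Finset.mul_sum,
      ← Finset.sum_mul]
    ring
  rw [this]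
  refine mul_nonneg (Finset.sum_nonneg fun _ _ => Finset.sum_nonneg fun _ _ =>
    mul_star_self_nonneg _) ?_
  rw [show (2 : ℂ)⁻¹ = ((2⁻¹ : ℝ) : ℂ) by norm_num]
  exact Complex.zero_le_real.mpr (by norm_num)

end PairForm

/-! ### Averaging over one noisy gate, and the dichotomy for the noise -/

section GateForm

open Matrix

theorem continuous_end (N : Module.End ℂ PairOp) : Continuous N :=
  LinearMap.continuous_of_finiteDimensional (E := PairOp) (F' := PairOp) N

theorem conjBy_apply (V X : PairOp) : conjBy V X = V * X * Vᴴ := rfl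

theorem continuous_conjBy (X : PairOp) : Continuous fun V : PairOp => conjBy V X := by
  simp only [conjBy_apply]
  fun_prop

theorem continuous_gate_pairForm (N : Module.End ℂ PairOp) (s t : Bool) (Y Z : PairOp) :
    Continuous fun V : Gate => pairForm s t (N (conjBy V Y)) (N (conjBy V Z)) := by
  have h (X : PairOp) : Continuous fun V : Gate => N (conjBy V X) :=
    (continuous_end N).comp ((continuous_conjBy X).comp continuous_subtype_val)
  simp only [pairForm_apply]
  refine continuous_finsetSum _ fun a _ => continuous_finsetSum _ fun b _ => ?_
  exact ((h Y).matrix_elem _ _).mul ((h Z).matrix_elem _ _)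

theorem integrable_of_continuous {α E : Type*} [TopologicalSpace α] [CompactSpace α]
    [MeasurableSpace α] [OpensMeasurableSpace α] [NormedAddCommGroup E] {μ : Measure α}
    [IsFiniteMeasure μ] {f : α → E} (hf : Continuous f) : Integrable f μ :=
  hf.integrable_of_hasCompactSupport (HasCompactSupport.of_compactSpace f)

/-- The Haar average of `pairForm s t` over the outputs of a noisy random gate. -/
noncomputable def gateForm (N : Module.End ℂ PairOp) (s t : Bool) :
    PairOp →ₗ[ℂ] PairOp →ₗ[ℂ] ℂ :=
  LinearMap.mk₂ ℂ
    (fun Y Z => ∫ V : Gate, pairForm s t (N (conjBy V Y)) (N (conjBy V Z)) ∂haarGate)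
    (fun Y Y' Z => by
      simp only [map_add, LinearMap.add_apply]
      exact integral_add (integrable_of_continuous (continuous_gate_pairForm N s t Y Z))
        (integrable_of_continuous (continuous_gate_pairForm N s t Y' Z)))
    (fun c Y Z => by
      simp only [map_smul, LinearMap.smul_apply]
      exact integral_smul _ _)
    (fun Y Z Z' => by
      simp only [map_add]
      exact integral_add (integrable_of_continuous (continuous_gate_pairForm N s t Y Z))
        (integrable_of_continuous (continuous_gate_pairForm N s t Y Z')))
    (fun c Y Z => by
      simp only [map_smul]
      exact integral_smul _ _)

variable {N : Module.End ℂ PairOp}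

theorem gateForm_apply (s t : Bool) (Y Z : PairOp) :
    gateForm N s t Y Z =
      ∫ V : Gate, pairForm s t (N (conjBy V Y)) (N (conjBy V Z)) ∂haarGate := rfl

theorem conjBy_conjBy (V W X : PairOp) : conjBy V (conjBy W X) = conjBy (V * W) X := by
  simp only [conjBy_apply, conjTranspose_mul, mul_assoc]

theorem trace_conjBy (V : Gate) (X : PairOp) : (conjBy (V : PairOp) X).trace = X.trace := by
  have hV : (V : PairOp)ᴴ * (V : PairOp) = 1 := Unitary.coe_star_mul_self V
  rw [conjBy_apply, Matrix.trace_mul_comm, ← mul_assoc, hV, one_mul]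

/-- Conjugating both inputs by `W` replaces `V` by `V * W`, which right invariance absorbs. -/
theorem conjInvariant_gateForm (s t : Bool) : ConjInvariant (gateForm N s t) := by
  intro W Y Z
  have : ∀ X, (W : PairOp) * X * (W : PairOp)ᴴ = conjBy W X := fun _ => rfl
  simp only [this, gateForm_apply, conjBy_conjBy]
  exact integral_mul_right_eq_self
    (fun V : Gate => pairForm s t (N (conjBy V Y)) (N (conjBy V Z))) W

theorem gateForm_comm (s t : Bool) (Y Z : PairOp) : gateForm N s t Y Z = gateForm N s t Z Y := by
  simp only [gateForm_apply]
  exact integral_congr_ae (Filter.Eventually.of_forall fun V => pairForm_comm _ _ _ _)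

/-- The purity of the qubits marked by `s` and `t` after the noisy gate `V`, for the input
`|00⟩⟨00|`. -/
noncomputable def gatePurity (N : Module.End ℂ PairOp) (s t : Bool) (V : Gate) : ℂ :=
  pairForm s t (N (conjBy V (single (0, 0) (0, 0) 1))) (N (conjBy V (single (0, 0) (0, 0) 1)))

theorem continuous_gatePurity (s t : Bool) : Continuous (gatePurity N s t) :=
  continuous_gate_pairForm N s t _ _

/-- The mean purity of the qubits marked by `s` and `t` after a noisy random gate, for a pure
input. -/
noncomputable def meanPurity (N : Module.End ℂ PairOp) (s t : Bool) : ℂ :=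
  gateForm N s t (single (0, 0) (0, 0) 1) (single (0, 0) (0, 0) 1)

theorem meanPurity_eq (s t : Bool) : meanPurity N s t = ∫ V, gatePurity N s t V ∂haarGate := rfl

/-- The mean overlap of the outputs of a noisy random gate for two orthogonal pure inputs. -/
noncomputable def meanOverlap (N : Module.End ℂ PairOp) (s t : Bool) : ℂ :=
  gateForm N s t (single (0, 0) (0, 0) 1) (single (1, 1) (1, 1) 1)

theorem gateForm_eq (s t : Bool) (Y Z : PairOp) :
    gateForm N s t Y Z = meanOverlap N s t * (Y.trace * Z.trace) +
      (meanPurity N s t - meanOverlap N s t) * (Y * Z).trace :=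
  (conjInvariant_gateForm s t).apply_eq (gateForm_comm s t) (by decide) Y Z

theorem conjBy_single (M : PairOp) (a : Pair) :
    conjBy M (single a a 1) = rankOne fun x => M x a := by
  ext x y
  rw [conjBy_apply, Matrix.mul_apply, Finset.sum_eq_single a]
  · simp [rankOne, vecMulVec_apply]
  · intro b _ hb
    rw [Matrix.mul_single_apply_of_ne (hbj := hb), zero_mul]
  · simp

/-- The Kraus vectors of the output for the input `V |a⟩⟨a| V†`. -/
def krausVec {r : ℕ} (K : Fin r → PairOp) (V : Gate) (a : Pair) (k : Fin r) : Pair → ℂ :=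
  fun x => (K k * (V : PairOp)) x a

section Kraus

variable {r : ℕ} {K : Fin r → PairOp}

theorem kraus_apply_conjBy_single (hK : ∀ X, N X = ∑ k, K k * X * (K k)ᴴ) (V : Gate) (a : Pair) :
    N (conjBy V (single a a 1)) = ∑ k, rankOne (krausVec K V a k) := by
  rw [hK]
  refine Finset.sum_congr rfl fun k _ => ?_
  rw [← conjBy_apply, conjBy_conjBy, conjBy_single]
  rfl

theorem trace_kraus (hK1 : ∑ k, (K k)ᴴ * K k = 1) (hK : ∀ X, N X = ∑ k, K k * X * (K k)ᴴ)
    (X : PairOp) : (N X).trace = X.trace := by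
  rw [hK, Matrix.trace_sum]
  have : ∀ k, (K k * X * (K k)ᴴ).trace = ((K k)ᴴ * K k * X).trace := fun k => by
    rw [Matrix.trace_mul_comm, mul_assoc]
  simp only [this]
  rw [← Matrix.trace_sum, ← Finset.sum_mul, hK1, one_mul]

theorem isHermitian_kraus (hK : ∀ X, N X = ∑ k, K k * X * (K k)ᴴ) {X : PairOp}
    (hX : X.IsHermitian) : (N X).IsHermitian := by
  rw [hK, Matrix.IsHermitian, conjTranspose_sum]
  refine Finset.sum_congr rfl fun k _ => ?_
  rw [conjTranspose_mul, conjTranspose_mul, conjTranspose_conjTranspose, hX.eq, mul_assoc]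

theorem pairForm_kraus (hK : ∀ X, N X = ∑ k, K k * X * (K k)ᴴ) (s t : Bool) (V : Gate)
    (a b : Pair) :
    pairForm s t (N (conjBy V (single a a 1))) (N (conjBy V (single b b 1))) =
      ∑ k, ∑ l, pairForm s t (rankOne (krausVec K V a k)) (rankOne (krausVec K V b l)) := by
  simp only [kraus_apply_conjBy_single hK, map_sum, LinearMap.sum_apply]
  exact Finset.sum_comm

end Kraus

theorem IsChannel.trace_apply (hN : IsChannel N) (X : PairOp) : (N X).trace = X.trace := by
  obtain ⟨r, K, hK1, hK⟩ := hN
  exact trace_kraus hK1 hK X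

theorem IsChannel.isHermitian_apply (hN : IsChannel N) {X : PairOp} (hX : X.IsHermitian) :
    (N X).IsHermitian := by
  obtain ⟨r, K, hK1, hK⟩ := hN
  exact isHermitian_kraus hK hX

theorem isHermitian_conjBy (V : PairOp) {X : PairOp} (hX : X.IsHermitian) :
    (conjBy V X).IsHermitian :=
  isHermitian_mul_mul_conjTranspose V hX

theorem gateForm_false_false (hN : IsChannel N) (Y Z : PairOp) :
    gateForm N false false Y Z = Y.trace * Z.trace := by
  simp only [gateForm_apply, pairForm_false_false, hN.trace_apply, trace_conjBy]
  simp

theorem meanOverlap_nonneg (hN : IsChannel N) (s t : Bool) : 0 ≤ meanOverlap N s t := by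
  obtain ⟨r, K, hK1, hK⟩ := hN
  refine integral_nonneg fun V => ?_
  simp only [Pi.zero_apply, pairForm_kraus hK]
  exact Finset.sum_nonneg fun k _ => Finset.sum_nonneg fun l _ => pairForm_rankOne_nonneg _ _ _ _

/-- On the traceless difference of two orthogonal projections the averaged form equals twice this
quantity, and it is nonnegative on Hermitian operators. -/
theorem meanOverlap_le_meanPurity (hN : IsChannel N) (s t : Bool) :
    0 ≤ meanPurity N s t - meanOverlap N s t := by
  have hH : (single (0, 0) (0, 0) 1 - single (1, 1) (1, 1) 1 : PairOp).IsHermitian := by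
    rw [Matrix.IsHermitian, conjTranspose_sub, conjTranspose_single, conjTranspose_single, star_one]
  have h1 : 0 ≤ gateForm N s t (single (0, 0) (0, 0) 1 - single (1, 1) (1, 1) 1)
      (single (0, 0) (0, 0) 1 - single (1, 1) (1, 1) 1) :=
    integral_nonneg fun V =>
      pairForm_self_nonneg s t (hN.isHermitian_apply (isHermitian_conjBy _ hH))
  rw [gateForm_eq] at h1
  have h2 : (single (0, 0) (0, 0) 1 - single (1, 1) (1, 1) 1 : PairOp).trace = 0 := by
    rw [trace_sub, trace_single_eq_same, trace_single_eq_same, sub_self]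
  have h3 : ((single (0, 0) (0, 0) 1 - single (1, 1) (1, 1) 1 : PairOp) *
      (single (0, 0) (0, 0) 1 - single (1, 1) (1, 1) 1)).trace = 2 := by
    rw [sub_mul, mul_sub, mul_sub, single_mul_single_same, single_mul_single_same,
      single_mul_single_of_ne _ _ _ _ (by decide), single_mul_single_of_ne _ _ _ _ (by decide)]
    simp
    norm_num
  rw [h2, h3, zero_mul, mul_zero, zero_add] at h1
  have h4 : (0 : ℂ) ≤ 2⁻¹ := by
    rw [show (2 : ℂ)⁻¹ = ((2⁻¹ : ℝ) : ℂ) by norm_num]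
    exact Complex.zero_le_real.mpr (by norm_num)
  have := mul_nonneg h1 h4
  rwa [mul_assoc, mul_inv_cancel₀ two_ne_zero, mul_one] at this

theorem meanPurity_false_false (hN : IsChannel N) : meanPurity N false false = 1 := by
  rw [meanPurity, gateForm_false_false hN]
  simp

theorem meanOverlap_false_false (hN : IsChannel N) : meanOverlap N false false = 1 := by
  rw [meanOverlap, gateForm_false_false hN]
  simp

/-- The qubit swap is itself a gate: it commutes with `N` and is then absorbed by left invariance.
-/
theorem meanPurity_swap (hsymm : IsSwapSymmetric N) :
    meanPurity N false true = meanPurity N true false := by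
  let W : Gate := permUnitary (Equiv.prodComm (Fin 2) (Fin 2))
  have hW : ∀ X : PairOp, X.submatrix Prod.swap Prod.swap = conjBy W X := fun X =>
    (permUnitary_conj (Equiv.prodComm (Fin 2) (Fin 2)) X).symm
  have h : ∀ (V : Gate) (X : PairOp), pairForm false true (N (conjBy V X)) (N (conjBy V X)) =
      pairForm true false (N (conjBy ((W * V : Gate) : PairOp) X))
        (N (conjBy ((W * V : Gate) : PairOp) X)) := by
    intro V X
    rw [← pairForm_swap true false, ← hsymm, hW, conjBy_conjBy]
    rfl
  simp only [meanPurity, gateForm_apply, h]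
  exact integral_mul_left_eq_self (fun V : Gate => pairForm true false
    (N (conjBy (V : PairOp) _)) (N (conjBy (V : PairOp) _))) W

theorem meanPurity_subadditive (hN : IsChannel N) :
    0 ≤ 1 - meanPurity N true false - meanPurity N false true + meanPurity N true true := by
  rw [← meanPurity_false_false hN]
  obtain ⟨r, K, hK1, hK⟩ := hN
  have hc := fun s t => integrable_of_continuous (μ := haarGate) (continuous_gatePurity (N := N) s t)
  simp only [meanPurity_eq]
  have h1 := integral_sub (hc false false) (hc true false)
  have h2 := integral_sub ((hc false false).sub (hc true false)) (hc false true)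
  have h3 := integral_add (((hc false false).sub (hc true false)).sub (hc false true))
    (hc true true)
  simp only [Pi.sub_apply] at h2 h3
  rw [← h1, ← h2, ← h3]
  refine integral_nonneg fun V => ?_
  simp only [Pi.zero_apply, gatePurity, pairForm_kraus hK, ← Finset.sum_sub_distrib, ← Finset.sum_add_distrib]
  exact Finset.sum_nonneg fun k _ => Finset.sum_nonneg fun l _ => pairForm_rankOne_subadditive _ _

theorem meanPurity_gap (hN : IsChannel N) : 1 - meanPurity N true true =
    ∫ V : Gate, (gatePurity N false false V - gatePurity N true true V) ∂haarGate := by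
  have hc := fun s t => integrable_of_continuous (μ := haarGate) (continuous_gatePurity (N := N) s t)
  rw [integral_sub (hc _ _) (hc _ _), ← meanPurity_false_false hN, meanPurity_eq, meanPurity_eq]

theorem pairForm_gap_nonneg {r : ℕ} {K : Fin r → PairOp} (hK : ∀ X, N X = ∑ k, K k * X * (K k)ᴴ)
    (V : Gate) : 0 ≤ gatePurity N false false V - gatePurity N true true V := by
  simp only [gatePurity, pairForm_kraus hK, ← Finset.sum_sub_distrib]
  exact Finset.sum_nonneg fun k _ => Finset.sum_nonneg fun l _ => pairForm_rankOne_gap_nonneg _ _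

theorem meanPurity_true_true_le (hN : IsChannel N) : 0 ≤ 1 - meanPurity N true true := by
  rw [meanPurity_gap hN]
  obtain ⟨r, K, hK1, hK⟩ := hN
  exact integral_nonneg fun V => pairForm_gap_nonneg hK V

/-- The purity deficit is continuous and nonnegative in the gate with mean zero, so it vanishes at
every gate, Haar measure having full support. It is a sum of Cauchy–Schwarz defects of pairs of
Kraus vectors, each of which is then zero. -/
theorem parallel_krausVec (hN : IsChannel N) {r : ℕ} {K : Fin r → PairOp}
    (hK : ∀ X, N X = ∑ k, K k * X * (K k)ᴴ) (h : meanPurity N true true = 1) (V : Gate)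
    (k l : Fin r) : Parallel (krausVec K V (0, 0) k) (krausVec K V (0, 0) l) := by
  set f : Gate → ℂ := fun V => gatePurity N false false V - gatePurity N true true V with hf
  have hcont : Continuous f := (continuous_gatePurity false false).sub
    (continuous_gatePurity true true)
  have h0 : ∫ V, f V ∂haarGate = 0 := by
    rw [← meanPurity_gap hN, h, sub_self]
  have hre : ∀ V, 0 ≤ (f V).re := fun V => (Complex.nonneg_iff.mp (pairForm_gap_nonneg hK V)).1
  have hreint : ∫ V, (f V).re ∂haarGate = 0 := by
    have := integral_re (𝕜 := ℂ) (integrable_of_continuous (μ := haarGate) hcont)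
    simp only [RCLike.re_eq_complex_re] at this
    rw [this, h0, Complex.zero_re]
  have hcre : Continuous fun V => (f V).re := Complex.continuous_re.comp hcont
  have hz : (fun V => (f V).re) = 0 :=
    (hcre.ae_eq_iff_eq haarGate continuous_const).mp
      ((integral_eq_zero_iff_of_nonneg hre (integrable_of_continuous hcre)).mp hreint)
  have hV : f V = 0 := by
    have h1 := Complex.nonneg_iff.mp (pairForm_gap_nonneg hK V)
    exact Complex.ext (congrFun hz V) h1.2.symm
  simp only [hf, gatePurity, pairForm_kraus hK, ← Finset.sum_sub_distrib] at hV
  have nn := fun k l => pairForm_rankOne_gap_nonneg (krausVec K V (0, 0) k) (krausVec K V (0, 0) l)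
  rw [Finset.sum_eq_zero_iff_of_nonneg fun k _ => Finset.sum_nonneg fun l _ => nn k l] at hV
  have h1 := hV k (Finset.mem_univ _)
  rw [Finset.sum_eq_zero_iff_of_nonneg fun l _ => nn k l] at h1
  have h2 := h1 l (Finset.mem_univ _)
  rw [pairForm_rankOne_gap] at h2
  exact parallel_of_sum_eq_zero h2

theorem parallel_kraus_mulVec (hN : IsChannel N) {r : ℕ} {K : Fin r → PairOp}
    (hK : ∀ X, N X = ∑ k, K k * X * (K k)ᴴ) (h : meanPurity N true true = 1)
    (k l : Fin r) (ψ : Pair → ℂ) : Parallel (K k *ᵥ ψ) (K l *ᵥ ψ) := by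
  by_cases h0 : ψ = 0
  · intro x y
    simp [h0]
  let ψ' : EuclideanSpace ℂ Pair := WithLp.toLp 2 ψ
  have hne : ‖ψ'‖ ≠ 0 := norm_ne_zero_iff.mpr fun h => h0 (congrArg WithLp.ofLp h)
  obtain ⟨V, hV⟩ := exists_unitary_column ((0, 0) : Pair) (((‖ψ'‖⁻¹ : ℝ) : ℂ) • ψ') (by
    rw [norm_smul, Complex.norm_real, norm_inv, norm_norm, inv_mul_cancel₀ hne])
  have hk : ∀ j, krausVec K V (0, 0) j = ((‖ψ'‖⁻¹ : ℝ) : ℂ) • K j *ᵥ ψ := by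
    intro j
    ext x
    simp only [krausVec, Matrix.mul_apply, hV, Pi.smul_apply, mulVec, dotProduct, smul_eq_mul,
      Finset.mul_sum]
    refine Finset.sum_congr rfl fun y _ => ?_
    simp only [PiLp.smul_apply, smul_eq_mul, ψ']
    ring
  have hc : ((‖ψ'‖⁻¹ : ℝ) : ℂ) ≠ 0 := by exact_mod_cast inv_ne_zero hne
  intro x y
  have := parallel_krausVec hN hK h V k l x y
  simp only [hk, Pi.smul_apply, smul_eq_mul] at this
  refine mul_left_cancel₀ (mul_ne_zero hc hc) ?_
  linear_combination this

/-- A channel of output purity one is unitary or constant on the operators of a given trace. -/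
theorem isUnitaryChannel_or_constant (hN : IsChannel N) (h : meanPurity N true true = 1) :
    IsUnitaryChannel N ∨ ∀ X Y : PairOp, X.trace = Y.trace → N X = N Y := by
  have hN' := hN
  obtain ⟨r, K, hK1, hK⟩ := hN'
  -- Proportional Kraus operators combine into one, which trace preservation makes unitary. With a
  -- common range every output is a multiple of `v v†`, and the trace fixes the multiple.
  rcases parallel_family (parallel_kraus_mulVec hN hK h) with ⟨K₀, c, hc⟩ | ⟨v, w, hvw⟩
  · left
    set s : ℝ := ∑ k, Complex.normSq (c k) with hs
    have hs0 : 0 ≤ s := Finset.sum_nonneg fun k _ => Complex.normSq_nonneg _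
    have hsc : (s : ℂ) = ∑ k, c k * star (c k) := by
      rw [hs, Complex.ofReal_sum]
      exact Finset.sum_congr rfl fun k _ => (Complex.mul_conj _).symm
    have hsq : ((Real.sqrt s : ℝ) : ℂ) * ((Real.sqrt s : ℝ) : ℂ) = s := by
      rw [← Complex.ofReal_mul, Real.mul_self_sqrt hs0]
    have hst : star ((Real.sqrt s : ℝ) : ℂ) = ((Real.sqrt s : ℝ) : ℂ) := Complex.conj_ofReal _
    have hU : (((Real.sqrt s : ℝ) : ℂ) • K₀) ∈ Matrix.unitaryGroup Pair ℂ := by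
      rw [Matrix.mem_unitaryGroup_iff', star_eq_conjTranspose, conjTranspose_smul, smul_mul_smul_comm,
        hst, hsq, hsc, ← hK1, Finset.sum_smul]
      refine Finset.sum_congr rfl fun k _ => ?_
      rw [hc, conjTranspose_smul, smul_mul_smul_comm, mul_comm]
    refine ⟨⟨_, hU⟩, LinearMap.ext fun X => ?_⟩
    rw [hK, conjBy_apply, conjTranspose_smul, smul_mul_assoc, smul_mul_smul_comm, hst, hsq, hsc,
      Finset.sum_smul]
    refine Finset.sum_congr rfl fun k _ => ?_
    rw [hc, conjTranspose_smul, smul_mul_assoc, smul_mul_smul_comm]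
  · right
    let φ : PairOp → ℂ := fun X => ∑ k, w k ⬝ᵥ (X *ᵥ star (w k))
    have hφ : ∀ X, N X = φ X • rankOne v := by
      intro X
      rw [hK, Finset.sum_smul]
      refine Finset.sum_congr rfl fun k _ => ?_
      rw [hvw, conjTranspose_vecMulVec, vecMulVec_mul, vecMulVec_mul_vecMulVec, rankOne,
        dotProduct_mulVec]
      ext x y
      simp [vecMulVec_apply]
      ring
    intro X Y hXY
    have h1 := hN.trace_apply 1
    have hv : (rankOne v).trace ≠ 0 := by
      intro h0
      rw [hφ, trace_smul, h0, smul_zero, trace_one] at h1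
      simp at h1
    have h2 : φ X * (rankOne v).trace = φ Y * (rankOne v).trace := by
      rw [← smul_eq_mul, ← smul_eq_mul, ← trace_smul, ← trace_smul, ← hφ, ← hφ, hN.trace_apply,
        hN.trace_apply, hXY]
    rw [hφ, hφ, mul_right_cancel₀ hv h2]

/-- Weights of the average of the pair forms over a noisy random gate. -/
structure IsGateWeight (N : Module.End ℂ PairOp) (a b : Bool → Bool → ℝ) : Prop where
  left_nonneg : ∀ s t, 0 ≤ a s t
  right_nonneg : ∀ s t, 0 ≤ b s t
  left_false : a false false = 1
  right_false : b false false = 0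
  gateForm_eq : ∀ s t Y Z, gateForm N s t Y Z =
    a s t * pairForm false false Y Z + b s t * pairForm true true Y Z

/-- The average of the pair forms over a noisy random gate: a combination of `tr Y * tr Z` and
`tr (Y * Z)` with nonnegative weights, which either contract or have no second part. -/
theorem exists_gate_weights (hN : IsChannel N) (hsymm : IsSwapSymmetric N)
    (hnoisy : ¬ IsUnitaryChannel N) :
    ∃ a b : Bool → Bool → ℝ, IsGateWeight N a b ∧
      ∃ q : ℝ, 0 < q ∧ q < 1 ∧
        ((∀ s t, s = true ∨ t = true → a s t + b s t ≤ q) ∨ ∀ s t, b s t = 0) := by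
  have ho : ∀ s t, meanOverlap N s t = (meanOverlap N s t).re := fun s t =>
    Complex.ext rfl (Complex.nonneg_iff.mp (meanOverlap_nonneg hN s t)).2.symm
  have hd : ∀ s t, meanPurity N s t - meanOverlap N s t =
      (meanPurity N s t - meanOverlap N s t).re := fun s t =>
    Complex.ext rfl (Complex.nonneg_iff.mp (meanOverlap_le_meanPurity hN s t)).2.symm
  refine ⟨fun s t => (meanOverlap N s t).re, fun s t => (meanPurity N s t - meanOverlap N s t).re,
    ⟨fun s t => (Complex.nonneg_iff.mp (meanOverlap_nonneg hN s t)).1,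
    fun s t => (Complex.nonneg_iff.mp (meanOverlap_le_meanPurity hN s t)).1,
    by simp [meanOverlap_false_false hN],
    by simp [meanOverlap_false_false hN, meanPurity_false_false hN], fun s t Y Z => ?_⟩, ?_⟩
  · rw [← ho, ← hd, pairForm_false_false, pairForm_true_true, gateForm_eq]
  have hle := Complex.nonneg_iff.mp (meanPurity_true_true_le hN)
  have hsub := (Complex.nonneg_iff.mp (meanPurity_subadditive hN)).1
  rw [meanPurity_swap hsymm] at hsub
  have hsw := congrArg Complex.re (meanPurity_swap hsymm)
  simp only [Complex.sub_re, Complex.add_re, Complex.one_re, Complex.sub_im, Complex.one_im]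
    at hle hsub ⊢
  by_cases h1 : meanPurity N true true = 1
  -- For a replacement channel any `q` strictly between zero and one serves.
  · refine ⟨1 / 2, by norm_num, by norm_num, Or.inr fun s t => ?_⟩
    have hconst := (isUnitaryChannel_or_constant hN h1).resolve_left hnoisy
    have : meanOverlap N s t = meanPurity N s t := by
      simp only [meanOverlap, meanPurity, gateForm_apply]
      refine integral_congr_ae (Filter.Eventually.of_forall fun V => ?_)
      have : N (conjBy V (single (1, 1) (1, 1) 1)) = N (conjBy V (single (0, 0) (0, 0) 1)) :=
        hconst _ _ (by simp [trace_conjBy])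
      simp only [this]
    rw [this, sub_self]
  · have hlt : (meanPurity N true true).re < 1 := by
      refine lt_of_le_of_ne (by linarith [hle.1]) fun h2 => h1 ?_
      exact Complex.ext h2 (by simpa using hle.2)
    have hnn : 0 ≤ (meanPurity N true true).re := by
      have h2 := (Complex.nonneg_iff.mp (meanOverlap_nonneg hN true true)).1
      have h3 := (Complex.nonneg_iff.mp (meanOverlap_le_meanPurity hN true true)).1
      simp only [Complex.sub_re] at h3
      linarith
    -- Here `a + b` is the mean purity. Subadditivity with equal one-qubit purities `p₁` reads `2 p₁
    -- ≤ 1 + p`, and `p ≤ (1 + p) / 2` since `p < 1`.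
    refine ⟨(1 + (meanPurity N true true).re) / 2, by linarith, by linarith, Or.inl ?_⟩
    intro s t hst
    rcases s with _ | _ <;> rcases t with _ | _
    · simp at hst
    all_goals linarith

end GateForm

/-! ### Swap forms on `n` qubits -/

section SubForm

open Matrix

variable {n : ℕ}

/-- The trace of `X ⊗ X` against the swap operators of the qubits in `S`; for Hermitian `X` the
squared Hilbert-Schmidt norm of the partial trace of `X` to `S`. -/
def subForm (S : Finset (Fin n)) (X : QubitOp n) : ℂ :=
  ∑ x, ∑ y, X x (S.piecewise y x) * X y (S.piecewise x y)

theorem subForm_empty (X : QubitOp n) : subForm ∅ X = X.trace * X.trace := by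
  simp [subForm, Matrix.trace, Finset.sum_mul_sum]

theorem subForm_univ (X : QubitOp n) : subForm Finset.univ X = (X * X).trace := by
  simp [subForm, Matrix.trace, Matrix.mul_apply]

theorem continuous_subForm (S : Finset (Fin n)) : Continuous (subForm S) := by
  unfold subForm
  fun_prop

theorem setPair_left {i j : Fin n} (hij : i ≠ j) (x : Fin n → Fin 2) (a : Pair) :
    setPair i j x a i = a.1 := by
  simp [setPair, hij]

theorem setPair_right (i j : Fin n) (x : Fin n → Fin 2) (a : Pair) :
    setPair i j x a j = a.2 := by
  simp [setPair]

theorem setPair_of_ne {i j k : Fin n} (hi : k ≠ i) (hj : k ≠ j) (x : Fin n → Fin 2) (a : Pair) :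
    setPair i j x a k = x k := by
  simp [setPair, hi, hj]

theorem setPair_congr {i j : Fin n} {x x' : Fin n → Fin 2}
    (h : ∀ k, k ≠ i → k ≠ j → x k = x' k) : setPair i j x = setPair i j x' := by
  funext a k
  by_cases hj : k = j
  · subst hj; simp [setPair_right]
  by_cases hi : k = i
  · subst hi; simp [setPair_left hj]
  rw [setPair_of_ne hi hj, setPair_of_ne hi hj, h k hi hj]

theorem setPair_self {i j : Fin n} (x : Fin n → Fin 2) : setPair i j x (x i, x j) = x := by
  simp [setPair]

theorem sum_setPair {i j : Fin n} (hij : i ≠ j) (f : (Fin n → Fin 2) → ℂ) :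
    ∑ x, ∑ a, f (setPair i j x a) = 4 * ∑ x, f x := by
  have hinv : Function.Involutive fun p : (Fin n → Fin 2) × Pair =>
      (setPair i j p.1 p.2, ((p.1 i, p.1 j) : Pair)) := by
    rintro ⟨x, a⟩
    refine Prod.ext ?_ (Prod.ext (setPair_left hij x a) (setPair_right i j x a))
    have : setPair i j (setPair i j x a) = setPair i j x :=
      setPair_congr fun k hi hj => setPair_of_ne hi hj x a
    simp only [this, setPair_self]
  calc ∑ x, ∑ a, f (setPair i j x a)
      = ∑ p : (Fin n → Fin 2) × Pair, f (setPair i j p.1 p.2) := by rw [← Fintype.sum_prod_type']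
    _ = ∑ p : (Fin n → Fin 2) × Pair, f p.1 :=
        Fintype.sum_equiv hinv.toPerm _ _ fun p => rfl
    _ = 4 * ∑ x, f x := by
        rw [Fintype.sum_prod_type, Finset.mul_sum]
        simp

/-- The operator on the qubits `i` and `j` in the `x`, `y` block of the other qubits. -/
def pairBlock (i j : Fin n) (X : QubitOp n) (x y : Fin n → Fin 2) : PairOp :=
  X.submatrix (setPair i j x) (setPair i j y)

theorem onPair_apply (Φ : Module.End ℂ PairOp) (i j : Fin n) (X : QubitOp n)
    (x y : Fin n → Fin 2) :
    onPair Φ i j X x y = Φ (pairBlock i j X x y) (x i, x j) (y i, y j) := rfl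

theorem onPair_id (i j : Fin n) (X : QubitOp n) : onPair LinearMap.id i j X = X := by
  ext x y
  rw [onPair_apply]
  simp [pairBlock, setPair_self]

/-- The sums over `x` and `y` are refined by overwriting the bits at `i` and `j`. Each string then
occurs four times, whence `16⁻¹` for the two sums. -/
theorem subForm_onPair (Φ : Module.End ℂ PairOp) {i j : Fin n} (hij : i ≠ j)
    (S : Finset (Fin n)) (X : QubitOp n) :
    subForm S (onPair Φ i j X) = 16⁻¹ * ∑ x, ∑ y, pairForm (decide (i ∈ S)) (decide (j ∈ S))
      (Φ (pairBlock i j X x (S.piecewise y x))) (Φ (pairBlock i j X y (S.piecewise x y))) := by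
  have h2 : ∀ f : (Fin n → Fin 2) → (Fin n → Fin 2) → ℂ,
      ∑ x, ∑ y, f x y = 16⁻¹ * ∑ x, ∑ y, ∑ a, ∑ b, f (setPair i j x a) (setPair i j y b) := by
    intro f
    have : ∑ x, ∑ y, ∑ a, ∑ b, f (setPair i j x a) (setPair i j y b) =
        ∑ x, ∑ a, ∑ y, ∑ b, f (setPair i j x a) (setPair i j y b) :=
      Finset.sum_congr rfl fun x _ => Finset.sum_comm
    rw [this]
    simp only [sum_setPair hij (f _)]
    rw [sum_setPair hij fun x => 4 * ∑ y, f x y, ← Finset.mul_sum]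
    ring
  rw [subForm, h2]
  congr 1
  refine Finset.sum_congr rfl fun x _ => Finset.sum_congr rfl fun y _ => ?_
  rw [pairForm_apply]
  refine Finset.sum_congr rfl fun a _ => Finset.sum_congr rfl fun b _ => ?_
  have hb : ∀ (x y : Fin n → Fin 2) (a b : Pair),
      onPair Φ i j X (setPair i j x a) (S.piecewise (setPair i j y b) (setPair i j x a)) =
      Φ (pairBlock i j X x (S.piecewise y x)) a
        (pairMix (decide (i ∈ S)) (decide (j ∈ S)) a b) := by
    intro x y a b
    rw [onPair_apply]
    have e1 : setPair i j (setPair i j x a) = setPair i j x :=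
      setPair_congr fun k hi hj => setPair_of_ne hi hj x a
    have e2 : setPair i j (S.piecewise (setPair i j y b) (setPair i j x a)) =
        setPair i j (S.piecewise y x) := by
      refine setPair_congr fun k hi hj => ?_
      by_cases hk : k ∈ S <;> simp [hk, setPair_of_ne hi hj]
    have e3 : ((S.piecewise (setPair i j y b) (setPair i j x a) i,
        S.piecewise (setPair i j y b) (setPair i j x a) j) : Pair) =
        pairMix (decide (i ∈ S)) (decide (j ∈ S)) a b := by
      by_cases hi : i ∈ S <;> by_cases hj : j ∈ S <;>
        simp [hi, hj, pairMix, setPair_left hij, setPair_right]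
    rw [pairBlock, e1, e2, e3, setPair_left hij, setPair_right]
    rfl
  rw [hb, hb]

theorem pairBlock_congr {i j : Fin n} (X : QubitOp n) {x x' y y' : Fin n → Fin 2}
    (hx : ∀ k, k ≠ i → k ≠ j → x k = x' k) (hy : ∀ k, k ≠ i → k ≠ j → y k = y' k) :
    pairBlock i j X x y = pairBlock i j X x' y' := by
  rw [pairBlock, pairBlock, setPair_congr hx, setPair_congr hy]

/-- The identity map is put into `subForm_onPair`: blocks do not depend on the bits at `i` and `j`,
so changing `S` there affects only the marks of the pair form. -/
theorem subForm_sdiff {i j : Fin n} (hij : i ≠ j) (S : Finset (Fin n)) (X : QubitOp n) :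
    subForm (S \ {i, j}) X = 16⁻¹ * ∑ x, ∑ y, pairForm false false
      (pairBlock i j X x (S.piecewise y x)) (pairBlock i j X y (S.piecewise x y)) := by
  have hi : decide (i ∈ S \ {i, j}) = false := by simp
  have hj : decide (j ∈ S \ {i, j}) = false := by simp
  have h := subForm_onPair LinearMap.id hij (S \ {i, j}) X
  rw [onPair_id, hi, hj] at h
  have e : ∀ x y : Fin n → Fin 2, pairBlock i j X x ((S \ {i, j}).piecewise y x) =
      pairBlock i j X x (S.piecewise y x) := fun x y =>
    pairBlock_congr X (fun _ _ _ => rfl) fun k hi hj => by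
      by_cases hk : k ∈ S <;> simp [Finset.piecewise, hk, hi, hj]
  simpa only [LinearMap.id_apply, e] using h

theorem subForm_union {i j : Fin n} (hij : i ≠ j) (S : Finset (Fin n)) (X : QubitOp n) :
    subForm (S ∪ {i, j}) X = 16⁻¹ * ∑ x, ∑ y, pairForm true true
      (pairBlock i j X x (S.piecewise y x)) (pairBlock i j X y (S.piecewise x y)) := by
  have hi : decide (i ∈ S ∪ {i, j}) = true := by simp
  have hj : decide (j ∈ S ∪ {i, j}) = true := by simp
  have h := subForm_onPair LinearMap.id hij (S ∪ {i, j}) X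
  rw [onPair_id, hi, hj] at h
  have e : ∀ x y : Fin n → Fin 2, pairBlock i j X x ((S ∪ {i, j}).piecewise y x) =
      pairBlock i j X x (S.piecewise y x) := fun x y =>
    pairBlock_congr X (fun _ _ _ => rfl) fun k hi hj => by
      by_cases hk : k ∈ S <;> simp [Finset.piecewise, hk, hi, hj]
  simpa only [LinearMap.id_apply, e] using h

theorem onPair_conjTranspose {Φ : Module.End ℂ PairOp} (hΦ : ∀ X : PairOp, Φ Xᴴ = (Φ X)ᴴ)
    (i j : Fin n) (X : QubitOp n) : onPair Φ i j Xᴴ = (onPair Φ i j X)ᴴ := by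
  ext x y
  rw [conjTranspose_apply, onPair_apply, onPair_apply, ← conjTranspose_apply, ← hΦ]
  rfl

/-! ### States -/

theorem norm_apply_sq_le {X : QubitOp n} (hX : X.PosSemidef) (x y : Fin n → Fin 2) :
    ‖X x y‖ ^ 2 ≤ (X x x).re * (X y y).re := by
  have h := (hX.submatrix ![x, y]).det_nonneg
  rw [Matrix.det_fin_two] at h
  simp only [submatrix_apply, Matrix.cons_val_zero, Matrix.cons_val_one] at h
  have hd : ∀ z, ((X z z).re : ℂ) = X z z := fun z =>
    Complex.ext rfl (Complex.nonneg_iff.mp (hX.diag_nonneg (i := z))).2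
  rw [← hX.isHermitian.apply y x, ← hd x, ← hd y] at h
  have h2 : X x y * star (X x y) = ((‖X x y‖ ^ 2 : ℝ) : ℂ) := by
    rw [← Complex.normSq_eq_norm_sq]
    exact Complex.mul_conj _
  rw [h2, ← Complex.ofReal_mul, ← Complex.ofReal_sub, Complex.zero_le_real] at h
  linarith

/-- Positivity bounds each entry by its diagonal entries, and the arithmetic-geometric mean
inequality leaves two products of diagonal entries. Exchanging the bits in `S` is an involution on
pairs `(x, y)`, so both products sum to one. -/
theorem norm_subForm_polar_le {X Z : QubitOp n} (hX : IsState X) (hZ : IsState Z)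
    (S : Finset (Fin n)) :
    ‖∑ x, ∑ y, X x (S.piecewise y x) * Z y (S.piecewise x y)‖ ≤ 1 := by
  have hnn : ∀ {W : QubitOp n}, IsState W → ∀ z, 0 ≤ (W z z).re := fun hW z =>
    (Complex.nonneg_iff.mp (hW.1.diag_nonneg (i := z))).1
  have hsum : ∀ {W : QubitOp n}, IsState W → ∑ z, (W z z).re = 1 := fun {W} hW => by
    have := congrArg Complex.re hW.2
    simpa [Matrix.trace] using this
  have hterm : ∀ x y, ‖X x (S.piecewise y x) * Z y (S.piecewise x y)‖ ≤
      ((X x x).re * (Z y y).re + (X (S.piecewise y x) (S.piecewise y x)).re *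
        (Z (S.piecewise x y) (S.piecewise x y)).re) / 2 := by
    intro x y
    have h1 := norm_apply_sq_le hX.1 x (S.piecewise y x)
    have h2 := norm_apply_sq_le hZ.1 y (S.piecewise x y)
    rw [norm_mul]
    have h3 : (‖X x (S.piecewise y x)‖ * ‖Z y (S.piecewise x y)‖) ^ 2 ≤
        ((X x x).re * (Z y y).re) * ((X (S.piecewise y x) (S.piecewise y x)).re *
        (Z (S.piecewise x y) (S.piecewise x y)).re) := by
      calc _ = ‖X x (S.piecewise y x)‖ ^ 2 * ‖Z y (S.piecewise x y)‖ ^ 2 := mul_pow _ _ _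
        _ ≤ _ := mul_le_mul h1 h2 (sq_nonneg _) (mul_nonneg (hnn hX _) (hnn hX _))
        _ = _ := by ring
    refine abs_le_of_sq_le_sq' ?_ ?_ |>.2
    · nlinarith [sq_nonneg ((X x x).re * (Z y y).re - (X (S.piecewise y x) (S.piecewise y x)).re *
        (Z (S.piecewise x y) (S.piecewise x y)).re)]
    · exact div_nonneg (add_nonneg (mul_nonneg (hnn hX _) (hnn hZ _))
        (mul_nonneg (hnn hX _) (hnn hZ _))) zero_le_two
  have hprod : ∑ x, ∑ y, (X x x).re * (Z y y).re = 1 := by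
    rw [← Finset.sum_mul_sum, hsum hX, hsum hZ, one_mul]
  have hinv : Function.Involutive fun p : (Fin n → Fin 2) × (Fin n → Fin 2) =>
      (S.piecewise p.2 p.1, S.piecewise p.1 p.2) := by
    rintro ⟨x, y⟩
    refine Prod.ext ?_ ?_ <;>
    · funext k
      by_cases hk : k ∈ S <;> simp [hk]
  have hprod' : ∑ x, ∑ y, (X (S.piecewise y x) (S.piecewise y x)).re *
        (Z (S.piecewise x y) (S.piecewise x y)).re = 1 := by
    rw [← hprod, ← Fintype.sum_prod_type', ← Fintype.sum_prod_type']
    exact Fintype.sum_equiv hinv.toPerm _ _ fun p => rfl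
  calc _ ≤ ∑ x, ∑ y, ‖X x (S.piecewise y x) * Z y (S.piecewise x y)‖ :=
        (norm_sum_le _ _).trans (Finset.sum_le_sum fun x _ => norm_sum_le _ _)
    _ ≤ ∑ x, ∑ y, ((X x x).re * (Z y y).re + (X (S.piecewise y x) (S.piecewise y x)).re *
        (Z (S.piecewise x y) (S.piecewise x y)).re) / 2 :=
        Finset.sum_le_sum fun x _ => Finset.sum_le_sum fun y _ => hterm x y
    _ = 1 := by
        simp only [← Finset.sum_div, Finset.sum_add_distrib, hprod, hprod']
        norm_num

theorem subForm_sub_re_le {ρ σ : QubitOp n} (hρ : IsState ρ) (hσ : IsState σ)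
    (S : Finset (Fin n)) : (subForm S (ρ - σ)).re ≤ 4 := by
  have h : subForm S (ρ - σ) =
      (∑ x, ∑ y, ρ x (S.piecewise y x) * ρ y (S.piecewise x y)) -
      (∑ x, ∑ y, ρ x (S.piecewise y x) * σ y (S.piecewise x y)) -
      (∑ x, ∑ y, σ x (S.piecewise y x) * ρ y (S.piecewise x y)) +
      (∑ x, ∑ y, σ x (S.piecewise y x) * σ y (S.piecewise x y)) := by
    simp only [← Finset.sum_sub_distrib, ← Finset.sum_add_distrib, subForm, Matrix.sub_apply]
    refine Finset.sum_congr rfl fun x _ => Finset.sum_congr rfl fun y _ => ?_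
    ring
  rw [h, Complex.add_re, Complex.sub_re, Complex.sub_re]
  have b := fun {X Z : QubitOp n} (hX : IsState X) (hZ : IsState Z) =>
    abs_le.mp ((Complex.abs_re_le_norm _).trans (norm_subForm_polar_le hX hZ S))
  linarith [(b hρ hρ).2, (b hρ hσ).1, (b hσ hρ).1, (b hσ hσ).2]

/-! ### The trace norm -/

theorem traceNorm_sq_le {M : QubitOp n} (hM : M.IsHermitian) :
    traceNorm M ^ 2 ≤ 2 ^ n * (subForm Finset.univ M).re := by
  have hpos := (Matrix.posSemidef_conjTranspose_mul_self M).eigenvalues_nonneg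
  have h1 : (subForm Finset.univ M).re =
      ∑ x, (Matrix.isHermitian_conjTranspose_mul_self M).eigenvalues x := by
    have h := (Matrix.isHermitian_conjTranspose_mul_self M).trace_eq_sum_eigenvalues
    rw [subForm_univ]
    nth_rewrite 1 [← hM.eq]
    rw [h]
    simp
  rw [h1, traceNorm]
  refine (sq_sum_le_card_mul_sum_sq).trans_eq ?_
  have h2 : ∀ x, Real.sqrt ((Matrix.isHermitian_conjTranspose_mul_self M).eigenvalues x) ^ 2 =
      (Matrix.isHermitian_conjTranspose_mul_self M).eigenvalues x := fun x => Real.sq_sqrt (hpos x)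
  simp [h2]

/-- The arithmetic-geometric mean form of the bound of the trace norm by the Hilbert-Schmidt
norm. -/
theorem traceNorm_le {M : QubitOp n} (hM : M.IsHermitian) {s : ℝ} (hs : 0 < s) :
    traceNorm M ≤ (2 : ℝ) ^ ((n : ℝ) / 2) * (((subForm Finset.univ M).re / s + s) / 2) := by
  have h := traceNorm_sq_le hM
  have hd : ((2 : ℝ) ^ ((n : ℝ) / 2)) ^ 2 = 2 ^ n := by
    rw [← Real.rpow_natCast, ← Real.rpow_mul zero_le_two]
    norm_num
  set d := (2 : ℝ) ^ ((n : ℝ) / 2) with hdef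
  have hd0 : 0 < d := Real.rpow_pos_of_pos two_pos _
  set V := (subForm Finset.univ M).re
  have hV : 0 ≤ V := by
    rw [← hd] at h
    exact nonneg_of_mul_nonneg_right ((sq_nonneg _).trans h) (pow_pos hd0 2)
  rw [← hd] at h
  have hVs : V / s * s = V := div_mul_cancel₀ V hs.ne'
  refine abs_le_of_sq_le_sq' (h.trans ?_) (by positivity) |>.2
  rw [mul_pow]
  refine mul_le_mul_of_nonneg_left ?_ (sq_nonneg d)
  nlinarith [sq_nonneg (V / s - s)]

end SubForm

/-! ### Continuity of the trace norm and of the gates -/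

section Continuity

open Matrix

variable {n : ℕ}

open scoped Matrix.Norms.L2Operator in
theorem continuous_cfc_sqrt :
    Continuous fun M : QubitOp n => cfc Real.sqrt (Mᴴ * M) := by
  have hc : Continuous fun M : QubitOp n => Mᴴ * M := by fun_prop
  exact hc.cfc_of_mem_nhdsSet (s := Set.univ) Real.sqrt Filter.univ_mem
    (fun M => (isHermitian_conjTranspose_mul_self M).isSelfAdjoint)
    Real.continuous_sqrt.continuousOn

/-- Replaces the individual eigenvalues by the functional calculus, which is continuous in `M`;
continuity gives integrability over the compact space of gates. -/
theorem traceNorm_eq_re_trace_cfc (M : QubitOp n) :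
    traceNorm M = (cfc Real.sqrt (Mᴴ * M)).trace.re := by
  have hA := isHermitian_conjTranspose_mul_self M
  rw [hA.cfc_eq, IsHermitian.cfc, Unitary.conjStarAlgAut_apply, Matrix.trace_mul_comm, ← mul_assoc,
    Unitary.coe_star_mul_self, one_mul, Matrix.trace_diagonal, Complex.re_sum]
  rfl

theorem continuous_traceNorm : Continuous (traceNorm : QubitOp n → ℝ) := by
  rw [funext traceNorm_eq_re_trace_cfc]
  exact Complex.continuous_re.comp continuous_cfc_sqrt.matrix_trace

theorem continuous_noisyGate {α : Type*} [TopologicalSpace α] (N : Module.End ℂ PairOp) {m : ℕ}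
    (L : Layer n m) (g : Fin m) {V : α → Gate} {Y : α → QubitOp n} (hV : Continuous V)
    (hY : Continuous Y) : Continuous fun u => noisyGate N L g (V u) (Y u) := by
  refine continuous_matrix fun x y => ?_
  have hb : Continuous fun u => pairBlock (L (g, 0)) (L (g, 1)) (Y u) x y := hY.matrix_submatrix _ _
  have hU : Continuous fun u => ((V u : Gate) : PairOp) := continuous_subtype_val.comp hV
  have hconj : Continuous fun u => conjBy (V u : PairOp)
      (pairBlock (L (g, 0)) (L (g, 1)) (Y u) x y) := by
    simp only [conjBy_apply]
    exact (hU.matrix_mul hb).matrix_mul hU.matrix_conjTranspose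
  exact ((continuous_end N).comp hconj).matrix_elem _ _

end Continuity

/-! ### The averaged recursion over gates and layers -/

section Average

open Matrix

variable {n m D : ℕ}

/-- The family of gates that is `V` at the place `(l, g)` and trivial elsewhere. -/
def singleGate (l : Fin D) (g : Fin m) (V : Gate) : Fin D → Fin m → Gate :=
  Pi.mulSingle l (Pi.mulSingle g V)

theorem singleGate_mul_same (l : Fin D) (g : Fin m) (V : Gate) (U : Fin D → Fin m → Gate) :
    (singleGate l g V * U) l g = V * U l g := by
  simp [singleGate]

theorem singleGate_mul_of_ne (l : Fin D) {g g' : Fin m} (h : g' ≠ g) (V : Gate)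
    (U : Fin D → Fin m → Gate) : (singleGate l g V * U) l g' = U l g' := by
  simp [singleGate, h]

theorem singleGate_mul_of_ne_left {l l' : Fin D} (h : l' ≠ l) (g : Fin m) (V : Gate)
    (U : Fin D → Fin m → Gate) : (singleGate l g V * U) l' = U l' := by
  simp [singleGate, h]

/-- Averaging over one gate, with the others fixed. -/
theorem integral_average_gate (l : Fin D) (g : Fin m) {F : Gate → (Fin D → Fin m → Gate) → ℂ}
    (hF : Continuous (Function.uncurry F))
    (hinv : ∀ W V U, F W (singleGate l g V * U) = F W U) :
    ∫ U, F (U l g) U ∂(haarCircuit D m) = ∫ U, ∫ V, F V U ∂haarGate ∂(haarCircuit D m) := by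
  -- The gate at `(l, g)` is translated by `V`, leaving the integral unchanged, and the result is
  -- averaged over `V`. After Fubini, right invariance removes the factor `U l g`.
  have h1 : ∀ V : Gate, ∫ U, F (U l g) U ∂(haarCircuit D m) =
      ∫ U, F (V * U l g) U ∂(haarCircuit D m) := by
    intro V
    rw [← integral_mul_left_eq_self (fun U => F (U l g) U) (singleGate l g V)]
    simp only [singleGate_mul_same, hinv]
  have h2 : ∫ U, F (U l g) U ∂(haarCircuit D m) =
      ∫ V, ∫ U, F (V * U l g) U ∂(haarCircuit D m) ∂haarGate := by
    simp only [← h1]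
    simp
  have hc : Continuous (Function.uncurry fun (V : Gate) (U : Fin D → Fin m → Gate) =>
      F (V * U l g) U) := by
    have : Continuous fun p : Gate × (Fin D → Fin m → Gate) => (p.1 * p.2 l g, p.2) := by fun_prop
    exact hF.comp this
  rw [h2, integral_integral_swap (integrable_of_continuous hc)]
  refine integral_congr_ae (Filter.Eventually.of_forall fun U => ?_)
  exact integral_mul_right_eq_self (fun V => F V U) (U l g)

theorem integral_subForm_gate (N : Module.End ℂ PairOp) {a b : Bool → Bool → ℝ}
    (hab : IsGateWeight N a b)
    {i j : Fin n} (hij : i ≠ j) (S : Finset (Fin n)) (X : QubitOp n) :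
    ∫ V : Gate, subForm S (onPair (N ∘ₗ conjBy (V : PairOp)) i j X) ∂haarGate =
      a (decide (i ∈ S)) (decide (j ∈ S)) * subForm (S \ {i, j}) X +
      b (decide (i ∈ S)) (decide (j ∈ S)) * subForm (S ∪ {i, j}) X := by
  simp only [subForm_onPair _ hij, LinearMap.comp_apply]
  have hc : ∀ Y Z : PairOp, Integrable (fun V : Gate => pairForm (decide (i ∈ S)) (decide (j ∈ S))
      (N (conjBy V Y)) (N (conjBy V Z))) haarGate := fun Y Z =>
    integrable_of_continuous (continuous_gate_pairForm N _ _ Y Z)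
  rw [integral_const_mul, integral_finsetSum _ fun x _ => integrable_finsetSum _ fun y _ => hc _ _]
  simp only [integral_finsetSum _ fun y _ => hc _ _, ← gateForm_apply, hab.gateForm_eq]
  rw [subForm_sdiff hij, subForm_union hij]
  simp only [Finset.sum_add_distrib, ← Finset.mul_sum]
  ring

/-- The expectation of `subForm S` for a random operator. -/
noncomputable def meanSubForm (S : Finset (Fin n)) (Y : (Fin D → Fin m → Gate) → QubitOp n) : ℝ :=
  (∫ U, subForm S (Y U) ∂(haarCircuit D m)).re

theorem meanSubForm_noisyGate (N : Module.End ℂ PairOp) {a b : Bool → Bool → ℝ}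
    (hab : IsGateWeight N a b)
    (L : Layer n m) (l : Fin D) (g : Fin m) {Y : (Fin D → Fin m → Gate) → QubitOp n}
    (hY : Continuous Y) (hinv : ∀ V U, Y (singleGate l g V * U) = Y U) (S : Finset (Fin n)) :
    meanSubForm S (fun U => noisyGate N L g (U l g) (Y U)) =
      a (decide (L (g, 0) ∈ S)) (decide (L (g, 1) ∈ S)) *
        meanSubForm (S \ {L (g, 0), L (g, 1)}) Y +
      b (decide (L (g, 0) ∈ S)) (decide (L (g, 1) ∈ S)) *
        meanSubForm (S ∪ {L (g, 0), L (g, 1)}) Y := by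
  have hij : L (g, 0) ≠ L (g, 1) := fun h => by simpa using L.injective h
  have hF : Continuous (Function.uncurry fun (V : Gate) (U : Fin D → Fin m → Gate) =>
      subForm S (noisyGate N L g V (Y U))) :=
    (continuous_subForm S).comp
      (continuous_noisyGate N L g continuous_fst (hY.comp continuous_snd))
  have h := integral_average_gate l g hF fun W V U => by rw [hinv]
  have hc : ∀ T : Finset (Fin n), Integrable (fun U => subForm T (Y U)) (haarCircuit D m) :=
    fun T => integrable_of_continuous ((continuous_subForm T).comp hY)
  simp only [noisyGate, integral_subForm_gate N hab hij] at h
  rw [integral_add ((hc _).const_mul _) ((hc _).const_mul _), integral_const_mul,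
    integral_const_mul] at h
  simp only [meanSubForm, noisyGate]
  rw [h, Complex.add_re, Complex.re_ofReal_mul, Complex.re_ofReal_mul]

/-- The gates `gs` of layer `l`, the first in the list acting last. -/
def gateProd (N : Module.End ℂ PairOp) (L : Layer n m) (l : Fin D) (gs : List (Fin m))
    (Y : (Fin D → Fin m → Gate) → QubitOp n) (U : Fin D → Fin m → Gate) : QubitOp n :=
  (gs.map fun g => noisyGate N L g (U l g)).prod (Y U)

section GateProd

variable {N : Module.End ℂ PairOp} {L : Layer n m} {l : Fin D}
  {Y : (Fin D → Fin m → Gate) → QubitOp n}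

theorem gateProd_nil : gateProd N L l [] Y = Y := by
  funext U
  simp [gateProd]

theorem gateProd_cons (g : Fin m) (gs : List (Fin m)) :
    gateProd N L l (g :: gs) Y = fun U => noisyGate N L g (U l g) (gateProd N L l gs Y U) := by
  funext U
  simp [gateProd]

theorem continuous_gateProd (hY : Continuous Y) (gs : List (Fin m)) :
    Continuous (gateProd N L l gs Y) := by
  induction gs with
  | nil => rwa [gateProd_nil]
  | cons g gs ih =>
    rw [gateProd_cons]
    exact continuous_noisyGate N L g (by fun_prop) ih

/-- Independence of the gate at `(l, g)` is expressed as invariance under its translations. -/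
theorem gateProd_singleGate (hinv : ∀ g V U, Y (singleGate l g V * U) = Y U) {g : Fin m}
    {gs : List (Fin m)} (hg : g ∉ gs) (V : Gate) (U : Fin D → Fin m → Gate) :
    gateProd N L l gs Y (singleGate l g V * U) = gateProd N L l gs Y U := by
  rw [gateProd, gateProd, hinv]
  congr 2
  refine List.map_congr_left fun g' hg' => ?_
  have hne : g' ≠ g := fun h => hg (by rwa [← h])
  rw [singleGate_mul_of_ne l hne]

variable {a b : Bool → Bool → ℝ}

theorem meanSubForm_gateProd_cons (hab : IsGateWeight N a b) (hY : Continuous Y)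
    (hinv : ∀ g V U, Y (singleGate l g V * U) = Y U) {g : Fin m} {gs : List (Fin m)}
    (hg : g ∉ gs) (S : Finset (Fin n)) :
    meanSubForm S (gateProd N L l (g :: gs) Y) =
      a (decide (L (g, 0) ∈ S)) (decide (L (g, 1) ∈ S)) *
        meanSubForm (S \ {L (g, 0), L (g, 1)}) (gateProd N L l gs Y) +
      b (decide (L (g, 0) ∈ S)) (decide (L (g, 1) ∈ S)) *
        meanSubForm (S ∪ {L (g, 0), L (g, 1)}) (gateProd N L l gs Y) := by
  rw [gateProd_cons]
  exact meanSubForm_noisyGate N hab L l g (continuous_gateProd hY gs)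
    (fun V U => gateProd_singleGate hinv hg V U) S

theorem meanSubForm_gateProd_cons_of_notMem (hab : IsGateWeight N a b) (hY : Continuous Y)
    (hinv : ∀ g V U, Y (singleGate l g V * U) = Y U) {g : Fin m} {gs : List (Fin m)}
    (hg : g ∉ gs) {S : Finset (Fin n)} (h0 : L (g, 0) ∉ S) (h1 : L (g, 1) ∉ S) :
    meanSubForm S (gateProd N L l (g :: gs) Y) = meanSubForm S (gateProd N L l gs Y) := by
  have hS : S \ {L (g, 0), L (g, 1)} = S := by
    rw [Finset.sdiff_eq_self_iff_disjoint]
    simp [h0, h1]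
  rw [meanSubForm_gateProd_cons hab hY hinv hg, decide_eq_false h0, decide_eq_false h1,
    hab.left_false, hab.right_false, hS]
  ring

theorem meanSubForm_empty_gateProd (hab : IsGateWeight N a b) (hY : Continuous Y)
    (hinv : ∀ g V U, Y (singleGate l g V * U) = Y U) {gs : List (Fin m)} (hgs : gs.Nodup) :
    meanSubForm ∅ (gateProd N L l gs Y) = meanSubForm ∅ Y := by
  induction gs with
  | nil => rw [gateProd_nil]
  | cons g gs ih =>
    rw [List.nodup_cons] at hgs
    rw [meanSubForm_gateProd_cons_of_notMem hab hY hinv hgs.1 (Finset.notMem_empty _)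
      (Finset.notMem_empty _), ih hgs.2]

/-- Going back from the last gate, gates that miss `S` change nothing. The first one met that
touches `S` gives the factor `q`; the remaining ones only have to preserve the bound `c`, for
whatever set that gate has produced. -/
theorem meanSubForm_gateProd_le (hab : IsGateWeight N a b) (hY : Continuous Y)
    (hinv : ∀ g V U, Y (singleGate l g V * U) = Y U) {q : ℝ} (hq1 : q ≤ 1)
    (hq : ∀ s t, s = true ∨ t = true → a s t + b s t ≤ q) {c : ℝ} (hc0 : 0 ≤ c)
    (hc : ∀ T, meanSubForm T Y ≤ c) {gs : List (Fin m)} (hgs : gs.Nodup) (S : Finset (Fin n)) :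
    meanSubForm S (gateProd N L l gs Y) ≤ c ∧
      ((∃ g ∈ gs, L (g, 0) ∈ S ∨ L (g, 1) ∈ S) →
        meanSubForm S (gateProd N L l gs Y) ≤ q * c) := by
  induction gs generalizing S with
  | nil =>
    rw [gateProd_nil]
    exact ⟨hc S, fun ⟨g, hg, _⟩ => absurd hg List.not_mem_nil⟩
  | cons g gs ih =>
    rw [List.nodup_cons] at hgs
    by_cases hS : L (g, 0) ∈ S ∨ L (g, 1) ∈ S
    · have hw := hq (decide (L (g, 0) ∈ S)) (decide (L (g, 1) ∈ S)) (by simpa using hS)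
      have hle : meanSubForm S (gateProd N L l (g :: gs) Y) ≤ q * c := by
        rw [meanSubForm_gateProd_cons hab hY hinv hgs.1]
        calc _ ≤ a (decide (L (g, 0) ∈ S)) (decide (L (g, 1) ∈ S)) * c +
              b (decide (L (g, 0) ∈ S)) (decide (L (g, 1) ∈ S)) * c :=
              add_le_add (mul_le_mul_of_nonneg_left (ih hgs.2 _).1 (hab.left_nonneg _ _))
                (mul_le_mul_of_nonneg_left (ih hgs.2 _).1 (hab.right_nonneg _ _))
          _ ≤ q * c := by
              rw [← add_mul]
              exact mul_le_mul_of_nonneg_right hw hc0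
      exact ⟨hle.trans (mul_le_of_le_one_left hc0 hq1), fun _ => hle⟩
    · push Not at hS
      rw [meanSubForm_gateProd_cons_of_notMem hab hY hinv hgs.1 hS.1 hS.2]
      refine ⟨(ih hgs.2 S).1, fun ⟨g', hg', h'⟩ => (ih hgs.2 S).2 ⟨g', ?_, h'⟩⟩
      rcases List.mem_cons.mp hg' with rfl | hg'
      · exact absurd h' (not_or.mpr hS)
      · exact hg'

/-- Each gate only deletes its pair from `S`, so gates covering `S` reduce it to `∅`. -/
theorem meanSubForm_gateProd_eq_zero (hab : IsGateWeight N a b) (hY : Continuous Y)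
    (hinv : ∀ g V U, Y (singleGate l g V * U) = Y U) (hb : ∀ s t, b s t = 0)
    (h0 : meanSubForm ∅ Y = 0) {gs : List (Fin m)} (hgs : gs.Nodup) {S : Finset (Fin n)}
    (hS : ∀ x ∈ S, ∃ g ∈ gs, x = L (g, 0) ∨ x = L (g, 1)) :
    meanSubForm S (gateProd N L l gs Y) = 0 := by
  induction gs generalizing S with
  | nil =>
    rw [gateProd_nil]
    have : S = ∅ := Finset.eq_empty_of_forall_notMem fun x hx => by simpa using hS x hx
    rw [this, h0]
  | cons g gs ih =>
    rw [List.nodup_cons] at hgs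
    rw [meanSubForm_gateProd_cons hab hY hinv hgs.1, hb, zero_mul, add_zero, ih hgs.2, mul_zero]
    intro x hx
    rw [Finset.mem_sdiff] at hx
    obtain ⟨g', hg', h'⟩ := hS x hx.1
    rcases List.mem_cons.mp hg' with rfl | hg'
    · exact absurd (by simpa using h') hx.2
    · exact ⟨g', hg', h'⟩

theorem exists_gate_of_qubit (L : Layer n m) (x : Fin n) :
    ∃ g ∈ (List.finRange m).reverse, x = L (g, 0) ∨ x = L (g, 1) := by
  obtain ⟨⟨g, k⟩, rfl⟩ := L.surjective x
  refine ⟨g, by simp, ?_⟩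
  fin_cases k <;> simp

theorem meanSubForm_layer_le (hab : IsGateWeight N a b) (hY : Continuous Y)
    (hinv : ∀ g V U, Y (singleGate l g V * U) = Y U) {q : ℝ} (hq0 : 0 < q) (hq1 : q < 1)
    (hq : (∀ s t, s = true ∨ t = true → a s t + b s t ≤ q) ∨ ∀ s t, b s t = 0)
    {c : ℝ} (hc0 : 0 ≤ c) (hc : ∀ T, meanSubForm T Y ≤ c) (h0 : meanSubForm ∅ Y = 0)
    (S : Finset (Fin n)) :
    meanSubForm S (gateProd N L l (List.finRange m).reverse Y) ≤ q * c := by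
  have hnd : (List.finRange m).reverse.Nodup := List.nodup_reverse.mpr (List.nodup_finRange m)
  rcases hq with hq | hq
  · rcases S.eq_empty_or_nonempty with rfl | ⟨x, hx⟩
    · rw [meanSubForm_empty_gateProd hab hY hinv hnd, h0]
      positivity
    · refine (meanSubForm_gateProd_le hab hY hinv hq1.le hq hc0 hc hnd S).2 ?_
      obtain ⟨g, hg, h | h⟩ := exists_gate_of_qubit L x
      · exact ⟨g, hg, Or.inl (h ▸ hx)⟩
      · exact ⟨g, hg, Or.inr (h ▸ hx)⟩
  · rw [meanSubForm_gateProd_eq_zero hab hY hinv hq h0 hnd fun x _ => exists_gate_of_qubit L x]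
    positivity

end GateProd

/-- The layers `ls` of the circuit, the first in the list acting last. -/
def layerProd (N : Module.End ℂ PairOp) (A : Fin D → Layer n m) (X : QubitOp n)
    (ls : List (Fin D)) (U : Fin D → Fin m → Gate) : QubitOp n :=
  (ls.map fun l => noisyLayer N (A l) (U l)).prod X

theorem noisyCircuit_eq_layerProd (N : Module.End ℂ PairOp) (A : Fin D → Layer n m)
    (X : QubitOp n) (U : Fin D → Fin m → Gate) :
    noisyCircuit N A U X = layerProd N A X (List.finRange D).reverse U := by
  rw [noisyCircuit, layerProd, List.ofFn_eq_map, List.map_reverse]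

section LayerProd

variable {N : Module.End ℂ PairOp} {A : Fin D → Layer n m} {X : QubitOp n}

theorem layerProd_nil : layerProd N A X [] = fun _ => X := by
  funext U
  simp [layerProd]

theorem layerProd_cons (l : Fin D) (ls : List (Fin D)) : layerProd N A X (l :: ls) =
    gateProd N (A l) l (List.finRange m).reverse (layerProd N A X ls) := by
  funext U
  rw [layerProd, List.map_cons, List.prod_cons, Module.End.mul_apply, noisyLayer,
    List.ofFn_eq_map, ← List.map_reverse]
  rfl

theorem continuous_layerProd (ls : List (Fin D)) : Continuous (layerProd N A X ls) := by
  induction ls with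
  | nil => rw [layerProd_nil]; exact continuous_const
  | cons l ls ih => rw [layerProd_cons]; exact continuous_gateProd ih _

theorem layerProd_singleGate {l : Fin D} {ls : List (Fin D)} (hl : l ∉ ls) (g : Fin m) (V : Gate)
    (U : Fin D → Fin m → Gate) :
    layerProd N A X ls (singleGate l g V * U) = layerProd N A X ls U := by
  rw [layerProd, layerProd]
  congr 2
  refine List.map_congr_left fun l' hl' => ?_
  have hne : l' ≠ l := fun h => hl (by rwa [← h])
  rw [singleGate_mul_of_ne_left hne]

/-- The vanishing at `∅` is carried along because no gate contracts that term. -/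
theorem meanSubForm_layerProd_le {a b : Bool → Bool → ℝ} (hab : IsGateWeight N a b) {q : ℝ}
    (hq0 : 0 < q) (hq1 : q < 1)
    (hq : (∀ s t, s = true ∨ t = true → a s t + b s t ≤ q) ∨ ∀ s t, b s t = 0)
    {c : ℝ} (hc0 : 0 ≤ c) (hc : ∀ T, (subForm T X).re ≤ c) (h0 : X.trace = 0)
    {ls : List (Fin D)} (hls : ls.Nodup) :
    (∀ S, meanSubForm S (layerProd N A X ls) ≤ q ^ ls.length * c) ∧
      meanSubForm ∅ (layerProd N A X ls) = 0 := by
  induction ls with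
  | nil => simpa [layerProd_nil, meanSubForm, subForm_empty, h0] using hc
  | cons l ls ih =>
    rw [List.nodup_cons] at hls
    obtain ⟨ih1, ih2⟩ := ih hls.2
    have hY : Continuous (layerProd N A X ls) := continuous_layerProd ls
    have hinv : ∀ g V U, layerProd N A X ls (singleGate l g V * U) = layerProd N A X ls U :=
      layerProd_singleGate hls.1
    rw [layerProd_cons]
    refine ⟨fun S => ?_, ?_⟩
    · rw [List.length_cons, pow_succ', mul_assoc]
      exact meanSubForm_layer_le hab hY hinv hq0 hq1 hq (by positivity) ih1 ih2 S
    · rw [meanSubForm_empty_gateProd hab hY hinv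
        (List.nodup_reverse.mpr (List.nodup_finRange m)), ih2]

end LayerProd

end Average

/-! ### Preservation of Hermiticity -/

section Hermitian

open Matrix

variable {n m D : ℕ} {N : Module.End ℂ PairOp}

theorem IsChannel.conjTranspose_apply (hN : IsChannel N) (X : PairOp) : N Xᴴ = (N X)ᴴ := by
  obtain ⟨r, K, -, hK⟩ := hN
  rw [hK, hK, conjTranspose_sum]
  refine Finset.sum_congr rfl fun k _ => ?_
  rw [conjTranspose_mul, conjTranspose_mul, conjTranspose_conjTranspose, mul_assoc]

theorem isHermitian_noisyGate (hN : IsChannel N) (L : Layer n m) (g : Fin m) (U : Gate)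
    {X : QubitOp n} (hX : X.IsHermitian) : (noisyGate N L g U X).IsHermitian := by
  have hΦ : ∀ Z : PairOp, (N ∘ₗ conjBy (U : PairOp)) Zᴴ = ((N ∘ₗ conjBy (U : PairOp)) Z)ᴴ := by
    intro Z
    rw [LinearMap.comp_apply, LinearMap.comp_apply, ← hN.conjTranspose_apply, conjBy_apply,
      conjBy_apply, conjTranspose_mul, conjTranspose_mul, conjTranspose_conjTranspose, mul_assoc]
  rw [Matrix.IsHermitian, noisyGate, ← onPair_conjTranspose hΦ, hX.eq]

theorem isHermitian_layerProd (hN : IsChannel N) (A : Fin D → Layer n m) {X : QubitOp n}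
    (hX : X.IsHermitian) (ls : List (Fin D)) (U : Fin D → Fin m → Gate) :
    (layerProd N A X ls U).IsHermitian := by
  induction ls with
  | nil => rwa [layerProd_nil]
  | cons l ls ih =>
    rw [layerProd_cons]
    generalize (List.finRange m).reverse = gs
    induction gs with
    | nil => rwa [gateProd_nil]
    | cons g gs ih' =>
      rw [gateProd_cons]
      exact isHermitian_noisyGate hN _ _ _ ih'

end Hermitian

end NoisyCircuit

/-! ### From the second moment to the trace norm -/

theorem mainTheorem8 (N : Module.End ℂ PairOp) (hN : IsChannel N) (hsymm : IsSwapSymmetric N)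
    (hnoisy : ¬ IsUnitaryChannel N) :
    ∃ Γ' : ℝ, 0 < Γ' ∧
      ∀ (n m D : ℕ) (A : Fin D → Layer n m) (ρ σ : QubitOp n), IsState ρ → IsState σ →
        Integrable (fun U => traceNorm (noisyCircuit N A U (ρ - σ))) (haarCircuit D m) ∧
        1 / 2 * ∫ U, traceNorm (noisyCircuit N A U (ρ - σ)) ∂(haarCircuit D m) ≤
          (2 : ℝ) ^ ((n : ℝ) / 2) * Real.exp (-Γ' * D) := by
  obtain ⟨a, b, hab, q, hq0, hq1, hq⟩ := exists_gate_weights hN hsymm hnoisy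
  -- Half the rate of the second moment, since the trace norm scales as its square root.
  refine ⟨-Real.log q / 2, by linarith [Real.log_neg hq0 hq1], fun n m D A ρ σ hρ hσ => ?_⟩
  simp only [noisyCircuit_eq_layerProd]
  set Y := layerProd N A (ρ - σ) (List.finRange D).reverse with hYdef
  have hY : Continuous Y := continuous_layerProd _
  have hint : Integrable (fun U => traceNorm (Y U)) (haarCircuit D m) :=
    integrable_of_continuous (continuous_traceNorm.comp hY)
  refine ⟨hint, ?_⟩
  have hV : Integrable (fun U => subForm Finset.univ (Y U)) (haarCircuit D m) :=
    integrable_of_continuous ((continuous_subForm _).comp hY)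
  have htr : (ρ - σ).trace = 0 := by rw [Matrix.trace_sub, hρ.2, hσ.2, sub_self]
  have hbound := (meanSubForm_layerProd_le (A := A) hab hq0 hq1 hq zero_le_four
    (subForm_sub_re_le hρ hσ) htr
    (List.nodup_reverse.mpr (List.nodup_finRange D))).1 Finset.univ
  rw [List.length_reverse, List.length_finRange, ← hYdef] at hbound
  have hre : ∫ U, (subForm Finset.univ (Y U)).re ∂(haarCircuit D m) =
      meanSubForm Finset.univ Y := integral_re (𝕜 := ℂ) hV
  have hVre : Integrable (fun U => (subForm Finset.univ (Y U)).re) (haarCircuit D m) := hV.re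
  set e := Real.exp (-(-Real.log q / 2) * D) with he
  have he0 : 0 < e := Real.exp_pos _
  have hee : e * e = q ^ D := by
    rw [he, ← Real.exp_add, ← Real.exp_log (pow_pos hq0 D), Real.log_pow]
    congr 1
    ring
  -- The second moment is at most `4 * q ^ D = (2 * e) ^ 2`, so `2 * e` is the matching parameter in
  -- the arithmetic-geometric mean bound `traceNorm_le`, which is linear in the second moment and
  -- can be integrated.
  have hs : 0 < 2 * e := by positivity
  have hmono : ∫ U, traceNorm (Y U) ∂(haarCircuit D m) ≤
      ∫ U, (2 : ℝ) ^ ((n : ℝ) / 2) * (((subForm Finset.univ (Y U)).re / (2 * e) + 2 * e) / 2)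
        ∂(haarCircuit D m) := by
    refine integral_mono hint ?_ fun U => traceNorm_le
      (isHermitian_layerProd hN A (hρ.1.isHermitian.sub hσ.1.isHermitian) _ U) hs
    exact (((hVre.div_const _).add (integrable_const _)).div_const _).const_mul _
  rw [integral_const_mul, integral_div,
    integral_add (hVre.div_const _) (integrable_const _), integral_div] at hmono
  simp only [hre, integral_const, probReal_univ, one_smul] at hmono
  have hdiv : meanSubForm Finset.univ Y / (2 * e) ≤ 2 * e := by
    rw [div_le_iff₀ hs]
    linarith
  have hd : (0 : ℝ) ≤ (2 : ℝ) ^ ((n : ℝ) / 2) := Real.rpow_nonneg zero_le_two _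
  have hfin : (2 : ℝ) ^ ((n : ℝ) / 2) * ((meanSubForm Finset.univ Y / (2 * e) + 2 * e) / 2) ≤
      (2 : ℝ) ^ ((n : ℝ) / 2) * (2 * e) := mul_le_mul_of_nonneg_left (by linarith) hd
  linarith
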